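/- **Setting.** Let $\mathbb T^d=(\mathbb R/2\pi\mathbb Z)^d$ with its flat distance $\operatorname{dist}_{\mathbb T^d}$ and with $\mathrm dx$ the Lebesgue measure normalized to total mass one. For mean-zero $\varphi\in L^2(\mathbb T^d;\mathbb C)$ with Fourier coefficients $\hat\varphi_j=\int_{\mathbb T^d}\varphi(x)e^{-ij\cdot x}\,\mathrm dx$, $j\in\mathbb Z^d$, put $\|\varphi\|_{\dot H^1}^2=\sum_{j}|j|^2|\hat\varphi_j|^2$; then $\varphi\in H^1(\mathbb T^d)$ means that this is finite. Let $\mathbb P_0$ be a probability measure on $\Omega_0=\mathbb R^d$ with a density with respect to Lebesgue measure, and let $\Omega=\Omega_0^{\mathbb N}$, $\mathbb P=\mathbb P_0^{\otimes\mathbb N}$, with elements $\underline\omega=(\omega_1,\omega_2,\dots)$. For every $A>0$ let $(\omega,x)\mapsto f_\omega(x)=f^A_\omega(x)$ be a map $\Omega_0\times\mathbb T^d\to\mathbb T^d$ of class $C^2$, and write $f^n_{\underline\omega}=f_{\omega_n}\circ\dots\circ f_{\omega_1}$, $f^0_{\underline\omega}=\mathrm{Id}$. Assume that for every $A>0$ there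 is $C_0=C_0(A)>0$ such that, for $\mathbb P_0$-a.e. $\omega$: for all $x$, $\|D_xf_\omega\|\le C_0$, $D_xf_\omega$ is invertible with $\|(D_xf_\omega)^{-1}\|\le C_0$, and $\|D^2_xf_\omega\|\le C_0$; the map $f_\omega$ is injective; and $f_\omega$ preserves Lebesgue measure. Let $P^{(2),n}((x,y),\cdot)$ denote the law of $(f^n_{\underline\omega}(x),f^n_{\underline\omega}(y))$ on $\mathbb T^d\times\mathbb T^d$, that is, the $n$-step transition probability of the two-point process. **Theorem.** For every $d$ and every $p\in(0,1)$ there is a constant $C'=C'(d,p)>0$ with the following property. Let $\mathbb P_0$ and $f^A_\omega$, $A>0$, be as above, and assume: 1. There are $m\in\mathbb N$ and $\gamma'\in(0,\tfrac12)$, independent of $A$, such that for all $A>0$, $x\in\mathbb T^d$ and $v\in\mathbb S^{d-1}$, $$\mathbb E\,\|D_xf^m_{\underline\omega}\,v\|^{-p}\le\gamma'.$$ 2. There are constants $C_1(A)$ with $C_1(A)\to+\infty$ as $A\to+\infty$ such that for all $A>0$, all $n\le m$ and a.e. $\underline\omega$, for all $x$, $$\|D_xf^n_{\underline\omega}\|\le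 C_1(A),\qquad \|D_x^2f^n_{\underline\omega}\|\le C_1(A).$$ 3. For all $A>0$ and $s>0$ there are an integer $k=k(A,s)\ge0$, a constant $C_2(A,s)\in(0,1)$ and a probability measure $\nu$ on $\mathbb T^d\times\mathbb T^d$ such that for all $x,y$ with $\operatorname{dist}_{\mathbb T^d}(x,y)\ge s$, $$P^{(2),mk}((x,y),\cdot)\ge C_2(A,s)\,\nu(\cdot).$$ Then there are constants $A_0,C'',s'>0$ such that for all $q>0$ and $A\ge A_0$, writing $$s_A:=C_1(A)^{-(2d-1)}s',\qquad \tau:=\min\bigl\{C_2(A,s_A),\,(m\,k(A,s_A))^{-1}\bigr\},$$ there is a random variable $\hat D:\Omega\to[0,\infty)$ such that: 1. for $\mathbb P$-a.e. $\underline\omega$, for all mean-zero $\varphi,\psi\in H^1(\mathbb T^d)$ and all integers $n\ge0$, $$\Bigl|\int_{\mathbb T^d}\varphi(x)\,\psi(f^n_{\underline\omega}(x))\,\mathrm dx\Bigr|\le\hat D(\underline\omega)\,e^{-\frac{C'}{1+q}\tau^2n}\,\|\varphi\|_{\dot H^1}\|\psi\|_{\dot H^1};$$ 2. $$\mathbb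 E[\hat D^q]\le C''\,2^{k(A,s_A)/2}\,C_1(A)^{(d-1)p/2}.$$ Here $A_0,C'',s'$ depend neither on $q$ nor on $A$. -/

import Mathlib

open Real Set Filter Topology MeasureTheory ProbabilityTheory
open scoped NNReal ENNReal

namespace TorusMixing

instance fact_two_pi_pos : Fact ((0 : ℝ) < 2 * π) := ⟨Real.two_pi_pos⟩

/-- Euclidean space `ℝᵈ`; it serves both as tangent space (universal cover) of the torus
and as noise space. -/
abbrev E (d : ℕ) : Type := EuclideanSpace ℝ (Fin d)

/-- The flat torus `𝕋ᵈ = (ℝ / 2πℤ)ᵈ`. -/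
abbrev T (d : ℕ) : Type := Fin d → AddCircle (2 * π)

/-- The covering map `ℝᵈ → 𝕋ᵈ`. -/
noncomputable def proj {d : ℕ} (x : E d) : T d := fun i => (x i : AddCircle (2 * π))

/-- Lebesgue measure on the torus, normalized to be a probability measure. -/
noncomputable def leb (d : ℕ) : Measure (T d) :=
  Measure.pi fun _ : Fin d => (AddCircle.haarAddCircle : Measure (AddCircle (2 * π)))

/-- The flat (Euclidean) distance on the torus: the Euclidean combination of the distances
of the coordinates on the circle `ℝ / 2πℤ`. -/
noncomputable def torusDist {d : ℕ} (x y : T d) : ℝ :=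
  √(∑ i, dist (x i) (y i) ^ 2)

/-- A family of maps `f_ω : 𝕋ᵈ → 𝕋ᵈ`, `ω ∈ ℝᵈ`, such that `(ω, x) ↦ f_ω(x)` is of class `C²`
on `ℝᵈ × 𝕋ᵈ`. As `ℝᵈ × ℝᵈ` is simply connected, this means that `(ω, x) ↦ f_ω(x)` has a lift
`ℝᵈ × ℝᵈ → ℝᵈ` through the covering map which is of class `C²`; the lift is unique up to the
addition of a constant vector of `2πℤᵈ`, so that its derivatives do not depend on choices. -/
structure C2Family (d : ℕ) where
  /-- the map `f_ω` of the torus -/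
  toFun : E d → T d → T d
  /-- the lift of `f_ω` -/
  lift : E d → E d → E d
  toFun_proj : ∀ ω x, toFun ω (proj x) = proj (lift ω x)
  contDiff_lift : ContDiff ℝ 2 fun z : E d × E d => lift z.1 z.2

namespace C2Family

variable {d : ℕ} (f : C2Family d)

/-- The random composition `f_ω^n = f_{ω_n} ∘ ⋯ ∘ f_{ω_1}`; the noise sequence
`(ω_1, ω_2, …)` is indexed by `ℕ` from `0`. -/
def iter : ℕ → (ℕ → E d) → T d → T d
  | 0, _, x => x
  | n + 1, ω, x => f.toFun (ω n) (iter n ω x)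

/-- The lift of the random composition `f_ω^n`. -/
def liftIter : ℕ → (ℕ → E d) → E d → E d
  | 0, _, x => x
  | n + 1, ω, x => f.lift (ω n) (liftIter n ω x)

theorem iter_proj (n : ℕ) (ω : ℕ → E d) (x : E d) :
    f.iter n ω (proj x) = proj (f.liftIter n ω x) := by
  induction n with
  | zero => rfl
  | succ n ih => simp only [iter, liftIter, ih, f.toFun_proj]

/-- The derivative `D_x f_ω`, at the point of the torus with representative `x`. -/
noncomputable def D (ω : E d) (x : E d) : E d →L[ℝ] E d :=
  fderiv ℝ (f.lift ω) x

/-- The second derivative `D²_x f_ω`, a bilinear map. -/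
noncomputable def D2 (ω : E d) (x : E d) : E d →L[ℝ] E d →L[ℝ] E d :=
  fderiv ℝ (fderiv ℝ (f.lift ω)) x

/-- The derivative `D_x f_ω^n` of the random composition. -/
noncomputable def DIter (n : ℕ) (ω : ℕ → E d) (x : E d) : E d →L[ℝ] E d :=
  fderiv ℝ (f.liftIter n ω) x

/-- The second derivative `D²_x f_ω^n` of the random composition. -/
noncomputable def D2Iter (n : ℕ) (ω : ℕ → E d) (x : E d) : E d →L[ℝ] E d →L[ℝ] E d :=
  fderiv ℝ (fderiv ℝ (f.liftIter n ω)) x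

end C2Family

/-- The law of an i.i.d. sequence `(ω_1, ω_2, …)` with common law `P₀`. -/
noncomputable def noiseLaw {d : ℕ} (P₀ : Measure (E d)) [IsProbabilityMeasure P₀] :
    Measure (ℕ → E d) :=
  Measure.infinitePi fun _ : ℕ => P₀

/-- The `n`-step transition probability `P^{(2),n}((x, y), ·)` of the two-point process: the
law of `(f_ω^n(x), f_ω^n(y))`. -/
noncomputable def twoPoint {d : ℕ} (P₀ : Measure (E d)) [IsProbabilityMeasure P₀]
    (f : C2Family d) (n : ℕ) (x y : T d) : Measure (T d × T d) :=
  (noiseLaw P₀).map fun ω => (f.iter n ω x, f.iter n ω y)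

/-- The structural hypotheses on a single system: absolutely continuous noise, almost sure
bounds on the first two derivatives and on the inverse of the first derivative, almost sure
injectivity (the two-point process stays off the diagonal) and preservation of Lebesgue
measure. The joint `C²` regularity is part of `C2Family`. -/
structure StandingHypothesis {d : ℕ} (P₀ : Measure (E d)) (f : C2Family d) : Prop where
  density : ∃ ρ₀ : E d → ℝ≥0∞, Measurable ρ₀ ∧ P₀ = volume.withDensity ρ₀
  bounds : ∃ C₀ : ℝ, 0 < C₀ ∧ ∀ᵐ ω ∂P₀, ∀ x,
    ‖f.D ω x‖ ≤ C₀ ∧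
    ((f.D ω x).IsInvertible ∧ ‖(f.D ω x).inverse‖ ≤ C₀) ∧
    ‖f.D2 ω x‖ ≤ C₀
  injective : ∀ᵐ ω ∂P₀, Function.Injective (f.toFun ω)
  preserves : ∀ᵐ ω ∂P₀, MeasurePreserving (f.toFun ω) (leb d) (leb d)

/-- The Fourier coefficient `φ̂_m = ∫ φ(x) e^{-i m·x} dx`, `m ∈ ℤᵈ`. -/
noncomputable def fourierCoef {d : ℕ} (φ : T d → ℂ) (m : Fin d → ℤ) : ℂ :=
  ∫ x, φ x * ∏ i, fourier (-(m i)) (x i) ∂(leb d)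

/-- `|m|² |φ̂_m|²`, where `|m|` is the Euclidean norm of `m ∈ ℤᵈ`. -/
noncomputable def sobolevTerm {d : ℕ} (φ : T d → ℂ) (m : Fin d → ℤ) : ℝ :=
  (∑ i, (m i : ℝ) ^ 2) * ‖fourierCoef φ m‖ ^ 2

/-- `φ` is a mean-zero element of the Sobolev space `H¹(𝕋ᵈ)`. -/
structure MeanZeroH1 {d : ℕ} (φ : T d → ℂ) : Prop where
  memLp : MemLp φ 2 (leb d)
  summable : Summable (sobolevTerm φ)
  mean_zero : ∫ x, φ x ∂(leb d) = 0

/-- The homogeneous Sobolev norm `‖φ‖_{Ḣ¹} = (∑ₘ |m|² |φ̂_m|²)^{1/2}`. -/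
noncomputable def H1norm {d : ℕ} (φ : T d → ℂ) : ℝ :=
  √(∑' m, sobolevTerm φ m)

end TorusMixing

/-!
The proof runs Harris' theorem for the two-point process and turns the resulting mean-square decay
of correlations into an almost sure statement by means of Fourier series.

**Drift.** A map that preserves volume has derivative of determinant at least one in absolute
value (`one_le_abs_det_fderiv`), so that its smallest singular value is at least `C^{-(d-1)}` if
its norm is at most `C` (`norm_le_pow_mul_norm_apply`). With `V(x, y) = dist(x, y)⁻ᵖ` and `C =
C₁(A)`, linearization and the contraction hypothesis give `P V ≤ V / 2` for `m` steps, at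
distances at most `δ C⁻ᵈ`, where `δ = 1 - 2γ'`. At larger distances the quantitative inverse
function theorem and injectivity give `dist(fᵐ x, fᵐ y) ≥ δ (1 - δ) C^{-(2d-1)}`. Hence `P V ≤ V /
2 + K` with `K = (c C^{-(2d-1)})⁻ᵖ`, `c = δ (1 - δ)` (`lTransition_lyapunov_le`). The scale `s_A`
is such that `{V ≤ 32 K}` lies in the set where the minorization holds.

**Harris.** With `α = C₂(A, s_A)` and `L = m k(A, s_A)`, the `L`-step two-point kernel contracts
the oscillation weighted by `1 + α V / (8 K)` by the factor `1 - α / 8` (`harris_contraction`).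
The weight is integrable, uniformly in `A`, because `p < 1` and `K ≥ 1`. As Lebesgue measure is
stationary, `𝔼 |∫ e_a · e_b ∘ fⁿ|² ≤ c₀ exp(-α n / (8 L))` for all Fourier modes with `b ≠ 0`,
where `c₀` depends only on `d` and `p` (`lintegral_enorm_modeCorr_sq_le_exp`).

**Almost sure bound.** The weighted sum `corrSum` of all these squares has mean `O(L / α)` and
dominates all correlations of modes simultaneously. Truncating Fourier series at a frequency that
depends on the size of this sum extends the bound to `H¹`, at the cost of the power `κ = 1 / (2 (d
+ 2))` (`MeanZeroH1.norm_integral_mul_comp_le_rpow`).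

**Moments.** Normalized correlations are at most one, so the random constant `S` may be replaced
by `S^{κ σ}` for `0 ≤ σ ≤ 1` if the rate is multiplied by `σ`. For `σ = θ / (1 + q)` its `q`-th
moment is at most `𝔼 S^θ`, of order `(L / α)^θ`. For `θ = min(α, L⁻¹) / (4 max(α, L⁻¹))` the rate
becomes a multiple of `min(α, L⁻¹)² / (1 + q)`, while `(L / α)^θ` is at most of order `√L`, and so
of order `2^{k/2}` (`rpow_min_div_max_le`).
-/

namespace TorusMixing

variable {d : ℕ}

/-! ### Geometry of the torus -/

/-- The covering map is an open quotient map; continuity of maps out of `ℝᵈ × 𝕋ᵈ` can therefore be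
checked on `ℝᵈ × ℝᵈ`. -/
theorem isOpenQuotientMap_proj : IsOpenQuotientMap (proj : E d → T d) := by
  have h : IsOpenQuotientMap
      (Pi.map fun (_ : Fin d) (t : ℝ) => (t : AddCircle (2 * π))) :=
    IsOpenQuotientMap.piMap fun _ => QuotientAddGroup.isOpenQuotientMap_mk
  exact h.comp (EuclideanSpace.equiv (Fin d) ℝ).toHomeomorph.isOpenQuotientMap

theorem continuous_proj : Continuous (proj : E d → T d) :=
  isOpenQuotientMap_proj.continuous

theorem surjective_proj : Function.Surjective (proj : E d → T d) :=
  isOpenQuotientMap_proj.surjective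

theorem continuous_torusDist : Continuous fun z : T d × T d => torusDist z.1 z.2 := by
  unfold torusDist
  fun_prop

theorem dist_apply_le_torusDist (x y : T d) (i : Fin d) : dist (x i) (y i) ≤ torusDist x y := by
  refine Real.le_sqrt_of_sq_le ?_
  exact Finset.single_le_sum (f := fun i => dist (x i) (y i) ^ 2) (fun _ _ => sq_nonneg _)
    (Finset.mem_univ i)

theorem dist_coe_coe (s t : ℝ) :
    dist (s : AddCircle (2 * π)) (t : AddCircle (2 * π)) = ‖((s - t : ℝ) : AddCircle (2 * π))‖ := by
  rw [dist_eq_norm, AddCircle.coe_sub]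

theorem torusDist_proj_le (X Y : E d) : torusDist (proj X) (proj Y) ≤ ‖X - Y‖ := by
  rw [EuclideanSpace.norm_eq]
  refine Real.sqrt_le_sqrt (Finset.sum_le_sum fun i _ => ?_)
  refine pow_le_pow_left₀ dist_nonneg ?_ 2
  rw [proj, proj, dist_coe_coe]
  exact QuotientAddGroup.norm_mk_le_norm

theorem torusDist_proj_eq {X Y : E d} (h : ‖X - Y‖ ≤ π) :
    torusDist (proj X) (proj Y) = ‖X - Y‖ := by
  rw [EuclideanSpace.norm_eq, torusDist]
  congr 1
  refine Finset.sum_congr rfl fun i _ => ?_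
  congr 1
  rw [proj, proj, dist_coe_coe, (AddCircle.norm_coe_eq_abs_iff _ Real.two_pi_pos.ne').2]
  · rfl
  · rw [abs_of_pos Real.two_pi_pos]
    have := PiLp.norm_apply_le (X - Y) i
    simp only [PiLp.sub_apply, Real.norm_eq_abs] at this
    linarith

/-- The torus distance is attained on suitable representatives. -/
theorem exists_proj_eq_norm_sub_eq (X : E d) (y : T d) :
    ∃ Y : E d, proj Y = y ∧ ‖Y - X‖ = torusDist (proj X) y := by
  have h1 : ∀ a : AddCircle (2 * π), ∃ t : ℝ, (t : AddCircle (2 * π)) = a ∧ |t| = ‖a‖ := by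
    intro a
    induction a using QuotientAddGroup.induction_on with
    | H t =>
      refine ⟨t - round ((2 * π)⁻¹ * t) * (2 * π), ?_, (AddCircle.norm_eq _).symm⟩
      rw [AddCircle.coe_sub, ← zsmul_eq_mul, AddCircle.coe_zsmul, AddCircle.coe_period, smul_zero,
        sub_zero]
  choose t ht ht' using fun i => h1 (y i - (X i : AddCircle (2 * π)))
  refine ⟨X + WithLp.toLp 2 t, ?_, ?_⟩
  · funext i
    simp [proj, ht]
  · rw [add_sub_cancel_left, EuclideanSpace.norm_eq, torusDist]
    congr 1
    refine Finset.sum_congr rfl fun i _ => ?_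
    rw [dist_comm, dist_eq_norm]
    simp [proj, ← ht']

instance : IsProbabilityMeasure (leb d) := by unfold leb; infer_instance

theorem pi_volume_eq_smul_leb :
    (Measure.pi fun _ : Fin d => (volume : Measure (AddCircle (2 * π)))) =
      ENNReal.ofReal (2 * π) ^ d • leb d := by
  refine Measure.pi_eq fun s _ => ?_
  simp [leb, AddCircle.volume_eq_smul_haarAddCircle, Finset.prod_mul_distrib]

/-- The half-open fundamental cube centred at `a`. -/
def cube (a : E d) : Set (E d) := {x | ∀ i, x i ∈ Ioc (a i - π) (a i - π + 2 * π)}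

theorem measurePreserving_proj (a : E d) :
    MeasurePreserving (proj : E d → T d) (volume.restrict (cube a))
      (ENNReal.ofReal (2 * π) ^ d • leb d) := by
  have h := measurePreserving_pi (ι := Fin d)
    (fun i => (volume : Measure ℝ).restrict (Ioc (a i - π) (a i - π + 2 * π)))
    (fun _ => (volume : Measure (AddCircle (2 * π))))
    (fun i => AddCircle.measurePreserving_mk (2 * π) (a i - π))
  rw [pi_volume_eq_smul_leb, ← Measure.restrict_pi_pi] at h
  have h2 := (PiLp.volume_preserving_ofLp (Fin d)).restrict_preimage
    (s := univ.pi fun i => Ioc (a i - π) (a i - π + 2 * π))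
    (MeasurableSet.univ_pi fun i => measurableSet_Ioc)
  have h3 : (@WithLp.ofLp 2 (Fin d → ℝ)) ⁻¹' (univ.pi fun i => Ioc (a i - π) (a i - π + 2 * π))
      = cube a := by
    ext x; simp [cube]
  rw [h3] at h2
  exact h.comp h2

/-- Compact sets inside a small ball are mapped by the covering map injectively, so that their
volume upstairs and downstairs agree up to the normalization. -/
theorem volume_eq_leb_image_proj {K : Set (E d)} (hK : IsCompact K) {a : E d} {r : ℝ} (hr : r < π)
    (h : K ⊆ Metric.closedBall a r) :
    volume K = ENNReal.ofReal (2 * π) ^ d * leb d (proj '' K) := by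
  have hcoord : ∀ x ∈ K, ∀ i, |x i - a i| < π := by
    intro x hx i
    have h1 := PiLp.norm_apply_le (x - a) i
    have h2 := mem_closedBall_iff_norm.1 (h hx)
    simp only [PiLp.sub_apply, Real.norm_eq_abs] at h1
    linarith
  have hcube : K ⊆ cube a := by
    intro x hx i
    have := abs_lt.1 (hcoord x hx i)
    constructor <;> linarith
  have hm : MeasurableSet (proj '' K) := (hK.image continuous_proj).measurableSet
  have := (measurePreserving_proj a).measure_preimage hm.nullMeasurableSet
  rw [Measure.restrict_apply (continuous_proj.measurable hm)] at this
  have hset : proj ⁻¹' (proj '' K) ∩ cube a = K := by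
    refine Subset.antisymm ?_ fun x hx => ⟨mem_image_of_mem _ hx, hcube hx⟩
    rintro x ⟨⟨y, hy, hxy⟩, hx⟩
    have : x = y := by
      ext i
      have h1 := congrFun hxy i
      exact ((AddCircle.coe_eq_coe_iff_of_mem_Ioc (hcube hy i) (hx i)).1 h1).symm
    exact this ▸ hy
  rw [hset] at this
  simpa using this

/-! ### Random compositions and noise -/

namespace C2Family

variable (f : C2Family d)

theorem contDiff_lift_apply (ω : E d) : ContDiff ℝ 2 (f.lift ω) :=
  f.contDiff_lift.comp (contDiff_const.prodMk contDiff_id)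

theorem contDiff_liftIter (n : ℕ) (ω : ℕ → E d) : ContDiff ℝ 2 (f.liftIter n ω) := by
  induction n with
  | zero => exact contDiff_id
  | succ n ih => exact (f.contDiff_lift_apply (ω n)).comp ih

theorem continuous_toFun : Continuous fun z : E d × T d => f.toFun z.1 z.2 := by
  have h := (IsOpenQuotientMap.id (X := E d)).prodMap (isOpenQuotientMap_proj (d := d))
  refine h.continuous_comp_iff.1 ?_
  have : (fun z : E d × T d => f.toFun z.1 z.2) ∘ Prod.map id proj =
      fun z : E d × E d => proj (f.lift z.1 z.2) := by
    funext z
    exact f.toFun_proj z.1 z.2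
  rw [this]
  exact continuous_proj.comp f.contDiff_lift.continuous

theorem continuous_iter (n : ℕ) : Continuous fun z : (ℕ → E d) × T d => f.iter n z.1 z.2 := by
  induction n with
  | zero => exact continuous_snd
  | succ n ih =>
    exact f.continuous_toFun.comp (((continuous_apply n).comp continuous_fst).prodMk ih)

theorem continuous_iter_pair (n : ℕ) :
    Continuous fun z : (ℕ → E d) × (T d × T d) => (f.iter n z.1 z.2.1, f.iter n z.1 z.2.2) := by
  refine Continuous.prodMk ?_ ?_
  · exact (f.continuous_iter n).comp (continuous_fst.prodMk (continuous_fst.comp continuous_snd))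
  · exact (f.continuous_iter n).comp (continuous_fst.prodMk (continuous_snd.comp continuous_snd))

theorem measurable_iter_pair (n : ℕ) :
    Measurable fun z : (ℕ → E d) × (T d × T d) => (f.iter n z.1 z.2.1, f.iter n z.1 z.2.2) :=
  (f.continuous_iter_pair n).measurable

theorem measurable_iter_pair_left (n : ℕ) (x y : T d) :
    Measurable fun ω : ℕ → E d => (f.iter n ω x, f.iter n ω y) :=
  ((f.continuous_iter_pair n).comp
    (continuous_id.prodMk (continuous_const (y := (x, y))))).measurable

end C2Family

/-- The sequence consisting of the first `n` entries of `ω`, followed by `ω'`. -/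
def splice (n : ℕ) (ω ω' : ℕ → E d) : ℕ → E d := fun i => if i < n then ω i else ω' (i - n)

theorem C2Family.iter_splice_of_le (f : C2Family d) {n k : ℕ} (hk : k ≤ n) (ω ω' : ℕ → E d)
    (x : T d) : f.iter k (splice n ω ω') x = f.iter k ω x := by
  induction k with
  | zero => rfl
  | succ k ih =>
    simp only [iter]
    rw [ih (by omega), splice, if_pos (by omega)]

/-- The cocycle property of the random compositions. -/
theorem C2Family.iter_add_splice (f : C2Family d) (n k : ℕ) (ω ω' : ℕ → E d) (x : T d) :
    f.iter (n + k) (splice n ω ω') x = f.iter k ω' (f.iter n ω x) := by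
  induction k with
  | zero => exact f.iter_splice_of_le le_rfl ω ω' x
  | succ k ih =>
    rw [← add_assoc]
    simp only [iter]
    rw [ih, splice, if_neg (by omega), Nat.add_sub_cancel_left]

variable (P₀ : Measure (E d)) [IsProbabilityMeasure P₀]

instance : IsProbabilityMeasure (noiseLaw P₀) := by unfold noiseLaw; infer_instance

theorem measurable_splice (n : ℕ) :
    Measurable fun z : (ℕ → E d) × (ℕ → E d) => splice n z.1 z.2 := by
  refine measurable_pi_lambda _ fun i => ?_
  unfold splice
  split_ifs <;> fun_prop

/-- Replacing the noise from time `n` on by an independent copy does not change its law. -/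
theorem map_splice (n : ℕ) :
    ((noiseLaw P₀).prod (noiseLaw P₀)).map (fun z => splice n z.1 z.2) = noiseLaw P₀ := by
  refine Measure.eq_infinitePi _ fun s t ht => ?_
  have ht' : MeasurableSet ((s : Set ℕ).pi t) :=
    MeasurableSet.pi s.countable_toSet fun i _ => ht i
  rw [Measure.map_apply (measurable_splice n) ht']
  set s₁ := s.filter (· < n) with hs₁
  set s₂ := s.filter (¬ · < n) with hs₂
  have hinj : InjOn (fun i => i - n) (s₂ : Set ℕ) := by
    intro i hi j hj hij
    simp only [hs₂, Finset.coe_filter, mem_ofPred_eq] at hi hj hij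
    omega
  have hset : (fun z : (ℕ → E d) × (ℕ → E d) => splice n z.1 z.2) ⁻¹' ((s : Set ℕ).pi t) =
      ((s₁ : Set ℕ).pi t) ×ˢ (((s₂.image fun i => i - n : Finset ℕ) : Set ℕ).pi
        fun i => t (i + n)) := by
    ext ⟨ω, ω'⟩
    simp only [mem_preimage, Set.mem_pi, splice, mem_prod, hs₁, hs₂, Finset.coe_image,
      Finset.coe_filter, mem_ofPred_eq, Finset.mem_coe, mem_image]
    constructor
    · intro h
      refine ⟨fun i hi => by simpa [hi.2] using h i hi.1, ?_⟩
      rintro _ ⟨i, hi, rfl⟩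
      have := h i hi.1
      rw [if_neg hi.2] at this
      rwa [Nat.sub_add_cancel (by omega)]
    · rintro ⟨h1, h2⟩ i hi
      split_ifs with hin
      · exact h1 i ⟨hi, hin⟩
      · have := h2 (i - n) ⟨i, ⟨hi, hin⟩, rfl⟩
        rwa [Nat.sub_add_cancel (by omega)] at this
  rw [hset, Measure.prod_prod, noiseLaw, Measure.infinitePi_pi _ fun i _ => ht i,
    Measure.infinitePi_pi _ fun i _ => ht (i + n), Finset.prod_image hinj,
    ← Finset.prod_filter_mul_prod_filter_not s (· < n)]
  congr 1
  refine Finset.prod_congr rfl fun i hi => ?_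
  simp only [Finset.mem_filter] at hi
  rw [Nat.sub_add_cancel (by omega)]

/-- A property of the noise that holds almost surely holds almost surely at all times. -/
theorem ae_forall_noise {q : E d → Prop} (h : ∀ᵐ ω ∂P₀, q ω) :
    ∀ᵐ ω ∂(noiseLaw P₀), ∀ i, q (ω i) := by
  rw [ae_all_iff]
  intro i
  exact (measurePreserving_eval_infinitePi (fun _ : ℕ => P₀) i).quasiMeasurePreserving.ae h

variable {P₀}

theorem ae_injective_iter {f : C2Family d} (hf : StandingHypothesis P₀ f) :
    ∀ᵐ ω ∂(noiseLaw P₀), ∀ n, Function.Injective (f.iter n ω) := by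
  filter_upwards [ae_forall_noise P₀ hf.injective] with ω hω n
  induction n with
  | zero => exact Function.injective_id
  | succ n ih => exact (hω n).comp ih

theorem ae_measurePreserving_iter {f : C2Family d} (hf : StandingHypothesis P₀ f) :
    ∀ᵐ ω ∂(noiseLaw P₀), ∀ n, MeasurePreserving (f.iter n ω) (leb d) (leb d) := by
  filter_upwards [ae_forall_noise P₀ hf.preserves] with ω hω n
  induction n with
  | zero => exact MeasurePreserving.id _
  | succ n ih => exact (hω n).comp ih

/-! ### The semigroup of the two-point motion -/

variable (P₀) in
/-- The transition semigroup of the two-point process acting on `[0, ∞]`-valued functions. -/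
noncomputable def lTransition (f : C2Family d) (n : ℕ) (V : T d × T d → ℝ≥0∞) (z : T d × T d) :
    ℝ≥0∞ :=
  ∫⁻ ω, V (f.iter n ω z.1, f.iter n ω z.2) ∂(noiseLaw P₀)

variable (P₀) in
/-- The transition semigroup of the two-point process acting on bounded real functions. -/
noncomputable def transition (f : C2Family d) (n : ℕ) (g : T d × T d → ℝ) (z : T d × T d) : ℝ :=
  ∫ ω, g (f.iter n ω z.1, f.iter n ω z.2) ∂(noiseLaw P₀)

theorem lTransition_eq_lintegral_twoPoint (f : C2Family d) (n : ℕ) {V : T d × T d → ℝ≥0∞}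
    (hV : Measurable V) (z : T d × T d) :
    lTransition P₀ f n V z = ∫⁻ w, V w ∂(twoPoint P₀ f n z.1 z.2) := by
  rw [twoPoint, lintegral_map hV (f.measurable_iter_pair_left n z.1 z.2), lTransition]

theorem transition_eq_integral_twoPoint (f : C2Family d) (n : ℕ) {g : T d × T d → ℝ}
    (hg : Measurable g) (z : T d × T d) :
    transition P₀ f n g z = ∫ w, g w ∂(twoPoint P₀ f n z.1 z.2) := by
  rw [twoPoint, integral_map (f.measurable_iter_pair_left n z.1 z.2).aemeasurable
    hg.aestronglyMeasurable, transition]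

instance (f : C2Family d) (n : ℕ) (x y : T d) : IsProbabilityMeasure (twoPoint P₀ f n x y) :=
  Measure.isProbabilityMeasure_map (f.measurable_iter_pair_left n x y).aemeasurable

theorem measurable_transition (f : C2Family d) (n : ℕ) {g : T d × T d → ℝ}
    (hg : Measurable g) : Measurable (transition P₀ f n g) := by
  have h : StronglyMeasurable fun z : (T d × T d) × (ℕ → E d) =>
      g (f.iter n z.2 z.1.1, f.iter n z.2 z.1.2) :=
    (hg.comp ((f.measurable_iter_pair n).comp measurable_swap)).stronglyMeasurable
  exact h.integral_prod_right.measurable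

theorem lTransition_add (f : C2Family d) (n k : ℕ) {V : T d × T d → ℝ≥0∞}
    (hV : Measurable V) (z : T d × T d) :
    lTransition P₀ f (n + k) V z = lTransition P₀ f n (lTransition P₀ f k V) z := by
  have hm : Measurable fun ω => V (f.iter (n + k) ω z.1, f.iter (n + k) ω z.2) :=
    hV.comp (f.measurable_iter_pair_left (n + k) z.1 z.2)
  rw [lTransition, ← map_splice P₀ n, lintegral_map hm (measurable_splice n),
    lintegral_prod (fun w : (ℕ → E d) × (ℕ → E d) =>
      V (f.iter (n + k) (splice n w.1 w.2) z.1, f.iter (n + k) (splice n w.1 w.2) z.2))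
      (hm.comp (measurable_splice n)).aemeasurable]
  simp only [lTransition, C2Family.iter_add_splice]

theorem transition_add (f : C2Family d) (n k : ℕ) {g : T d × T d → ℝ}
    (hg : Measurable g) {B : ℝ} (hB : ∀ z, |g z| ≤ B) (z : T d × T d) :
    transition P₀ f (n + k) g z = transition P₀ f n (transition P₀ f k g) z := by
  have hm : Measurable fun ω => g (f.iter (n + k) ω z.1, f.iter (n + k) ω z.2) :=
    hg.comp (f.measurable_iter_pair_left (n + k) z.1 z.2)
  rw [transition, ← map_splice P₀ n, integral_map (measurable_splice n).aemeasurable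
    hm.aestronglyMeasurable, integral_prod]
  · simp only [transition, C2Family.iter_add_splice]
  · exact Integrable.of_bound (hm.comp (measurable_splice n)).aestronglyMeasurable B
      (Eventually.of_forall fun _ => hB _)

theorem abs_transition_le (f : C2Family d) (n : ℕ) {g : T d × T d → ℝ} {B : ℝ}
    (hB : ∀ z, |g z| ≤ B) (z : T d × T d) : |transition P₀ f n g z| ≤ B := by
  have := norm_integral_le_of_norm_le_const (μ := noiseLaw P₀) (C := B)
    (f := fun ω => g (f.iter n ω z.1, f.iter n ω z.2)) (Eventually.of_forall fun _ => hB _)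
  simpa [transition] using this

/-- The product of two copies of Lebesgue measure is stationary for the two-point process. -/
theorem integral_transition {f : C2Family d} (hf : StandingHypothesis P₀ f) (n : ℕ)
    {g : T d × T d → ℝ} (hg : Measurable g) {B : ℝ} (hB : ∀ z, |g z| ≤ B) :
    ∫ z, transition P₀ f n g z ∂((leb d).prod (leb d)) = ∫ z, g z ∂((leb d).prod (leb d)) := by
  have hm : Measurable fun w : (T d × T d) × (ℕ → E d) =>
      g (f.iter n w.2 w.1.1, f.iter n w.2 w.1.2) :=
    hg.comp ((f.measurable_iter_pair n).comp measurable_swap)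
  unfold transition
  rw [integral_integral_swap]
  · have : ∀ᵐ ω ∂(noiseLaw P₀), ∫ z : T d × T d, g (f.iter n ω z.1, f.iter n ω z.2)
        ∂((leb d).prod (leb d)) = ∫ z, g z ∂((leb d).prod (leb d)) := by
      filter_upwards [ae_measurePreserving_iter hf] with ω hω
      have h2 := (hω n).prod (hω n)
      conv_rhs => rw [← h2.map_eq, integral_map h2.measurable.aemeasurable
        hg.aestronglyMeasurable]
      rfl
    rw [integral_congr_ae this]
    simp
  · exact Integrable.of_bound hm.aestronglyMeasurable B (Eventually.of_forall fun _ => hB _)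

/-! ### Expansion of the lifts -/

/-- Hadamard's inequality bounds the smallest singular value of a linear map from below in terms
of its norm, as soon as its determinant is not small. -/
theorem norm_le_pow_mul_norm_apply (A : E d →L[ℝ] E d) {C : ℝ} (hA : ‖A‖ ≤ C)
    (hdet : 1 ≤ |A.det|) (v : E d) : ‖v‖ ≤ C ^ (d - 1) * ‖A v‖ := by
  have hC : 0 ≤ C := (norm_nonneg A).trans hA
  rcases eq_or_ne v 0 with rfl | hv
  · simp
  have hd : 0 < d := by
    rcases Nat.eq_zero_or_pos d with rfl | h
    · exact absurd (Subsingleton.elim v 0) hv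
    · exact h
  have hv' : 0 < ‖v‖ := norm_pos_iff.2 hv
  set u : E d := ‖v‖⁻¹ • v with hu
  have hu1 : ‖u‖ = 1 := by rw [hu, norm_smul, norm_inv, norm_norm, inv_mul_cancel₀ hv'.ne']
  let i₀ : Fin d := ⟨0, hd⟩
  obtain ⟨b, hb⟩ := Orthonormal.exists_orthonormalBasis_extension_of_card_eq (𝕜 := ℝ)
    (E := E d) (ι := Fin d) (by simp) (v := fun _ => u) (s := {i₀})
    ⟨fun i => by simpa using hu1, fun i j hij => absurd (Subsingleton.elim i j) hij⟩
  have hb0 : b i₀ = u := hb i₀ rfl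
  have : Fact (Module.finrank ℝ (E d) = d) := ⟨by simp⟩
  let o : Orientation ℝ (E d) (Fin d) := b.toBasis.orientation
  have h1 := o.abs_volumeForm_apply_le (fun i => A (b i))
  rw [o.volumeForm_robust b rfl] at h1
  have h2 : b.toBasis.det (fun i => A (b i)) = A.det := by
    have := b.toBasis.det_comp (A : E d →ₗ[ℝ] E d) b.toBasis
    rw [b.toBasis.det_self, mul_one] at this
    have hfun : (fun i => A (b i)) = (A : E d →ₗ[ℝ] E d) ∘ b.toBasis := by
      funext i
      simp
    rw [hfun, this]
  rw [h2] at h1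
  have h3 : ∏ i, ‖A (b i)‖ ≤ ‖A u‖ * C ^ (d - 1) := by
    rw [← Finset.mul_prod_erase _ _ (Finset.mem_univ i₀), hb0]
    refine mul_le_mul_of_nonneg_left ?_ (norm_nonneg _)
    calc ∏ i ∈ Finset.univ.erase i₀, ‖A (b i)‖ ≤ ∏ _i ∈ Finset.univ.erase i₀, C :=
          Finset.prod_le_prod (fun _ _ => norm_nonneg _) fun i _ => by
            have := A.le_of_opNorm_le hA (b i)
            simpa using this
      _ = C ^ (d - 1) := by simp
  have h4 : ‖A u‖ = ‖v‖⁻¹ * ‖A v‖ := by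
    rw [hu, map_smul, norm_smul, norm_inv, norm_norm]
  have h5 := hdet.trans (h1.trans h3)
  rw [h4] at h5
  calc ‖v‖ = ‖v‖ * 1 := (mul_one _).symm
    _ ≤ ‖v‖ * (‖v‖⁻¹ * ‖A v‖ * C ^ (d - 1)) := by gcongr
    _ = C ^ (d - 1) * ‖A v‖ := by field_simp

section Lift

variable {F : T d → T d} {L : E d → E d}

/-- If `F` preserves Lebesgue measure, then its lifts cannot contract volumes. -/
theorem one_le_abs_det_fderiv (hL : ContDiff ℝ 1 L) (hFL : ∀ x, F (proj x) = proj (L x))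
    (hF : MeasurePreserving F (leb d) (leb d)) (x : E d) : 1 ≤ |(fderiv ℝ L x).det| := by
  by_contra! hlt
  obtain ⟨c, hc1, hc2⟩ := exists_between hlt
  have hcont : Continuous fun y => |(fderiv ℝ L y).det| :=
    (ContinuousLinearMap.continuous_det.comp (hL.continuous_fderiv one_ne_zero)).abs
  have hev1 : ∀ᶠ y in 𝓝 x, |(fderiv ℝ L y).det| < c := hcont.continuousAt.eventually_lt_const hc1
  have hev2 : ∀ᶠ y in 𝓝 x, L y ∈ Metric.closedBall (L x) 1 :=
    hL.continuous.continuousAt.eventually (Metric.closedBall_mem_nhds _ one_pos)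
  obtain ⟨ε, hε, hball⟩ := Metric.nhds_basis_closedBall.eventually_iff.1 (hev1.and hev2)
  set r := min ε 1 with hr
  have hr0 : 0 < r := lt_min hε one_pos
  set K := Metric.closedBall x r with hK
  have hKε : K ⊆ Metric.closedBall x ε := Metric.closedBall_subset_closedBall (min_le_left _ _)
  have hKc : IsCompact K := isCompact_closedBall x r
  have hLK : IsCompact (L '' K) := hKc.image hL.continuous
  have hπ : (1 : ℝ) < π := by linarith [Real.pi_gt_three]
  have e1 := volume_eq_leb_image_proj hKc ((min_le_right ε 1).trans_lt hπ) subset_rfl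
  have e2 := volume_eq_leb_image_proj hLK hπ (a := L x) (by
    rintro _ ⟨y, hy, rfl⟩
    exact (hball (hKε hy)).2)
  have e3 : leb d (proj '' K) ≤ leb d (proj '' (L '' K)) := by
    rw [← hF.measure_preimage (hLK.image continuous_proj).measurableSet.nullMeasurableSet]
    refine measure_mono ?_
    rintro _ ⟨y, hy, rfl⟩
    exact ⟨L y, mem_image_of_mem _ hy, (hFL y).symm⟩
  have e4 : volume K ≤ volume (L '' K) := by
    rw [e1, e2]
    gcongr
  have e5 : volume (L '' K) ≤ ∫⁻ y in K, ENNReal.ofReal |(fderiv ℝ L y).det| :=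
    addHaar_image_le_lintegral_abs_det_fderiv _ hKc.measurableSet fun y _ =>
      (hL.differentiable one_ne_zero y).hasFDerivAt.hasFDerivWithinAt
  have e6 : ∫⁻ y in K, ENNReal.ofReal |(fderiv ℝ L y).det| ≤ ENNReal.ofReal c * volume K := by
    rw [← setLIntegral_const]
    exact setLIntegral_mono measurable_const fun y hy =>
      ENNReal.ofReal_le_ofReal (hball (hKε hy)).1.le
  have hK0 : volume K ≠ 0 := (Metric.measure_closedBall_pos _ _ hr0).ne'
  have hK1 : volume K ≠ ∞ := hKc.measure_lt_top.ne
  have e7 : ENNReal.ofReal c * volume K < 1 * volume K :=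
    ENNReal.mul_lt_mul_left hK0 hK1 (ENNReal.ofReal_lt_one.2 hc2)
  rw [one_mul] at e7
  exact absurd ((e4.trans e5).trans e6) (not_le.2 e7)

variable {C δ : ℝ}

/-- On a ball of radius `r` the map is linear up to an error of Lipschitz constant `C r`. -/
theorem norm_sub_sub_fderiv_le (hL : ContDiff ℝ 2 L)
    (h2 : ∀ x, ‖fderiv ℝ (fderiv ℝ L) x‖ ≤ C) {X U W : E d} {r : ℝ}
    (hU : U ∈ Metric.closedBall X r) (hW : W ∈ Metric.closedBall X r) :
    ‖L U - L W - fderiv ℝ L X (U - W)‖ ≤ C * r * ‖U - W‖ := by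
  have hC : 0 ≤ C := (norm_nonneg (fderiv ℝ (fderiv ℝ L) X)).trans (h2 X)
  have hd : ContDiff ℝ 1 (fderiv ℝ L) := hL.fderiv_right (m := 1) (by norm_num)
  refine Convex.norm_image_sub_le_of_norm_fderiv_le' (𝕜 := ℝ) (s := Metric.closedBall X r)
    (fun x _ => hL.differentiable two_ne_zero x) (fun x hx => ?_) (convex_closedBall X r) hW hU
  have := Convex.norm_image_sub_le_of_norm_fderiv_le (𝕜 := ℝ) (f := fderiv ℝ L) (C := C)
    (s := univ) (x := X) (y := x) (fun x _ => hd.differentiable one_ne_zero x) (fun x _ => h2 x)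
    convex_univ trivial trivial
  refine this.trans (mul_le_mul_of_nonneg_left ?_ hC)
  simpa [dist_eq_norm] using hx

/-- Points at distance at most `δ C⁻ᵈ` separate at least as fast as the linearized motion, up to
the factor `1 - δ`. -/
theorem mul_norm_fderiv_le_torusDist (hd : 0 < d) (hL : ContDiff ℝ 2 L)
    (hFL : ∀ x, F (proj x) = proj (L x)) (hF : MeasurePreserving F (leb d) (leb d))
    (h1 : ∀ x, ‖fderiv ℝ L x‖ ≤ C) (h2 : ∀ x, ‖fderiv ℝ (fderiv ℝ L) x‖ ≤ C) (hC : 1 ≤ C)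
    (hδ : δ ≤ 1) {X Y : E d} (hXY : ‖Y - X‖ ≤ δ / C ^ d) :
    (1 - δ) * ‖fderiv ℝ L X (Y - X)‖ ≤ torusDist (F (proj X)) (F (proj Y)) := by
  have hC0 : 0 < C := one_pos.trans_le hC
  have hCd : C ^ d = C * C ^ (d - 1) := by
    rw [← pow_succ', Nat.sub_add_cancel hd]
  have hsing := norm_le_pow_mul_norm_apply (fderiv ℝ L X) (h1 X)
    (one_le_abs_det_fderiv (hL.of_le (by norm_num)) hFL hF X) (Y - X)
  have happ := norm_sub_sub_fderiv_le hL h2 (X := X) (r := ‖Y - X‖) (U := Y) (W := X)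
    (by simp [dist_eq_norm]) (by simp)
  have hmul : ‖Y - X‖ * C ^ d ≤ δ := (le_div_iff₀ (by positivity)).1 hXY
  have hlip : ‖L Y - L X‖ ≤ C * ‖Y - X‖ :=
    Convex.norm_image_sub_le_of_norm_fderiv_le (𝕜 := ℝ) (s := univ)
      (fun x _ => hL.differentiable two_ne_zero x) (fun x _ => h1 x) convex_univ trivial trivial
  have hone : C * ‖Y - X‖ ≤ 1 := by
    have : (1 : ℝ) ≤ C ^ (d - 1) := one_le_pow₀ hC
    have h0 := norm_nonneg (Y - X)
    calc C * ‖Y - X‖ ≤ C * ‖Y - X‖ * C ^ (d - 1) := le_mul_of_one_le_right (by positivity) this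
      _ = ‖Y - X‖ * C ^ d := by rw [hCd]; ring
      _ ≤ 1 := hmul.trans hδ
  rw [hFL, hFL, torusDist_proj_eq (by
    rw [norm_sub_rev]
    linarith [Real.pi_gt_three])]
  have h3 : C * ‖Y - X‖ * ‖Y - X‖ ≤ δ * ‖fderiv ℝ L X (Y - X)‖ := by
    calc C * ‖Y - X‖ * ‖Y - X‖ ≤ C * ‖Y - X‖ * (C ^ (d - 1) * ‖fderiv ℝ L X (Y - X)‖) := by gcongr
      _ = ‖Y - X‖ * C ^ d * ‖fderiv ℝ L X (Y - X)‖ := by rw [hCd]; ring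
      _ ≤ _ := by gcongr
  have h4 := norm_sub_norm_le (fderiv ℝ L X (Y - X)) (L Y - L X)
  rw [norm_sub_rev (fderiv ℝ L X (Y - X))] at h4
  rw [norm_sub_rev (L X)]
  linarith

/-- Points at distance more than `δ C⁻ᵈ` stay at distance at least `(1 - δ) δ C^{-(2d - 1)}`: by
the quantitative inverse function theorem every point closer to `F x` than this is the image of
a point close to `x`. -/
theorem div_pow_le_torusDist (hd : 0 < d) (hL : ContDiff ℝ 2 L)
    (hFL : ∀ x, F (proj x) = proj (L x)) (hF : MeasurePreserving F (leb d) (leb d))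
    (hinj : Function.Injective F)
    (h1 : ∀ x, ‖fderiv ℝ L x‖ ≤ C) (h2 : ∀ x, ‖fderiv ℝ (fderiv ℝ L) x‖ ≤ C) (hC : 1 ≤ C)
    (hδ : 0 < δ) {x y : T d} (hxy : δ / C ^ d < torusDist x y) :
    (1 - δ) * δ / C ^ (2 * d - 1) ≤ torusDist (F x) (F y) := by
  have hC0 : 0 < C := one_pos.trans_le hC
  have hCd : C ^ d = C * C ^ (d - 1) := by
    rw [← pow_succ', Nat.sub_add_cancel hd]
  have hC2d : C ^ (2 * d - 1) = C ^ (d - 1) * C ^ d := by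
    rw [← pow_add]
    congr 1
    omega
  by_contra! hlt
  obtain ⟨X, rfl⟩ := surjective_proj x
  obtain ⟨Y', hY', hdist⟩ := exists_proj_eq_norm_sub_eq (L X) (F y)
  set A := fderiv ℝ L X with hA
  have hsing : ∀ v, ‖v‖ ≤ C ^ (d - 1) * ‖A v‖ := norm_le_pow_mul_norm_apply A (h1 X)
    (one_le_abs_det_fderiv (hL.of_le (by norm_num)) hFL hF X)
  have hAinj : Function.Injective A := by
    refine (injective_iff_map_eq_zero A).2 fun v hv => ?_
    have := hsing v
    rw [hv, norm_zero, mul_zero] at this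
    exact norm_le_zero_iff.1 this
  have hAsurj : Function.Surjective A :=
    LinearMap.surjective_of_injective (f := (A : E d →ₗ[ℝ] E d)) hAinj
  choose g hg using hAsurj
  let R : A.NonlinearRightInverse :=
    { toFun := g
      nnnorm := ⟨C ^ (d - 1), by positivity⟩
      bound' := fun v => by
        have := hsing (g v)
        rwa [hg] at this
      right_inv' := hg }
  set r := δ / C ^ d with hr
  have hr0 : 0 < r := by positivity
  obtain ⟨c, hc⟩ : ∃ c : ℝ≥0, (c : ℝ) = C * r := ⟨⟨C * r, by positivity⟩, rfl⟩
  have happ : ApproximatesLinearOn L A (Metric.closedBall X r) c := fun u hu v hv => by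
    rw [hc]
    exact norm_sub_sub_fderiv_le hL h2 hu hv
  have hsurj := happ.surjOn_closedBall_of_nonlinearRightInverse R hr0.le subset_rfl
  have hrad : ((R.nnnorm : ℝ)⁻¹ - c) * r = (1 - δ) * δ / C ^ (2 * d - 1) := by
    change ((C ^ (d - 1))⁻¹ - c) * r = _
    rw [hc, hr, hC2d, hCd]
    field_simp
  rw [hrad] at hsurj
  obtain ⟨Z, hZ, hLZ⟩ := hsurj (mem_closedBall_iff_norm.2 (by
    rw [hdist, ← hFL]
    exact hlt.le))
  have hFy : F (proj Z) = F y := by rw [hFL, hLZ, hY']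
  have hZy : proj Z = y := hinj hFy
  have : torusDist (proj X) y ≤ r := by
    rw [← hZy]
    refine (torusDist_proj_le X Z).trans ?_
    rw [norm_sub_rev]
    exact mem_closedBall_iff_norm.1 hZ
  linarith

end Lift

/-! ### The drift condition -/

/-- The Lyapunov function `dist(x, y)⁻ᵖ` of the two-point process, infinite on the diagonal. -/
noncomputable def lyapunov (p : ℝ) (z : T d × T d) : ℝ≥0∞ :=
  ENNReal.ofReal (torusDist z.1 z.2) ^ (-p)

theorem measurable_lyapunov (p : ℝ) : Measurable (lyapunov (d := d) p) :=
  (ENNReal.measurable_ofReal.comp continuous_torusDist.measurable).pow_const _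

theorem lyapunov_le {p : ℝ} (hp : 0 ≤ p) {z : T d × T d} {s : ℝ} (h : s ≤ torusDist z.1 z.2) :
    lyapunov p z ≤ ENNReal.ofReal s ^ (-p) := by
  rw [lyapunov, ENNReal.rpow_neg, ENNReal.rpow_neg]
  gcongr

/-- The drift condition. Near the diagonal the linearized motion contracts the Lyapunov function by
`(2γ)⁻ᵖ γ ≤ 1 / 2`, where the first factor is the loss incurred by linearizing with error
`δ = 1 - 2γ`; away from the diagonal the Lyapunov function stays bounded. -/
theorem lTransition_lyapunov_le (hd : 0 < d) {f : C2Family d} (hf : StandingHypothesis P₀ f)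
    {p : ℝ} (hp : p ∈ Ioo (0 : ℝ) 1) {m : ℕ} {γ : ℝ} (hγ : γ ∈ Ioo (0 : ℝ) (1 / 2))
    (hcontr : ∀ x v : E d, ‖v‖ = 1 →
      ∫⁻ ω, ‖f.DIter m ω x v‖ₑ ^ (-p) ∂(noiseLaw P₀) ≤ ENNReal.ofReal γ)
    {C : ℝ} (hC : 1 ≤ C)
    (hbound : ∀ᵐ ω ∂(noiseLaw P₀), ∀ x, ‖f.DIter m ω x‖ ≤ C ∧ ‖f.D2Iter m ω x‖ ≤ C)
    (z : T d × T d) :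
    lTransition P₀ f m (lyapunov p) z ≤ 2⁻¹ * lyapunov p z +
      ENNReal.ofReal (2 * γ * (1 - 2 * γ) / C ^ (2 * d - 1)) ^ (-p) := by
  obtain ⟨x, y⟩ := z
  set δ := 1 - 2 * γ with hδ
  have hδ0 : 0 < δ := by rw [hδ]; linarith [hγ.2]
  have hδ1 : δ ≤ 1 := by rw [hδ]; linarith [hγ.1]
  have hδγ : 1 - δ = 2 * γ := by rw [hδ]; ring
  have h2γ : 0 < 2 * γ := by linarith [hγ.1]
  rcases le_or_gt (torusDist x y) (δ / C ^ d) with hnear | hfar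
  · refine le_add_right ?_
    -- a representative of `y` at minimal distance; it does not depend on the noise
    obtain ⟨X, rfl⟩ := surjective_proj x
    obtain ⟨Y, rfl, hXY⟩ := exists_proj_eq_norm_sub_eq X y
    rcases (norm_nonneg (Y - X)).eq_or_lt with h0 | hpos
    · have : lyapunov p (proj X, proj Y) = ∞ := by
        simp [lyapunov, ← hXY, ← h0, ENNReal.zero_rpow_of_neg (neg_lt_zero.2 hp.1)]
      rw [this, ENNReal.mul_top (by simp)]
      exact le_top
    set r := ‖Y - X‖ with hr
    set v : E d := r⁻¹ • (Y - X) with hv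
    have hv1 : ‖v‖ = 1 := by
      rw [hv, norm_smul, Real.norm_of_nonneg (inv_nonneg.2 hpos.le), ← hr, inv_mul_cancel₀ hpos.ne']
    have hV : lyapunov p (proj X, proj Y) = ENNReal.ofReal r ^ (-p) := by
      rw [lyapunov, ← hXY]
    have hkey : ∀ᵐ ω ∂(noiseLaw P₀),
        lyapunov p (f.iter m ω (proj X), f.iter m ω (proj Y)) ≤
          ENNReal.ofReal (2 * γ) ^ (-p) * ENNReal.ofReal r ^ (-p) *
            ‖f.DIter m ω X v‖ₑ ^ (-p) := by
      filter_upwards [hbound, ae_measurePreserving_iter hf] with ω hω hpres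
      have h := mul_norm_fderiv_le_torusDist (δ := δ) hd (f.contDiff_liftIter m ω)
        (f.iter_proj m ω) (hpres m) (fun x => (hω x).1) (fun x => (hω x).2) hC hδ1
        (X := X) (Y := Y) (by rw [← hr, hXY]; exact hnear)
      have hYX : Y - X = r • v := by rw [hv, smul_smul, mul_inv_cancel₀ hpos.ne', one_smul]
      rw [hYX, map_smul, norm_smul, Real.norm_of_nonneg hpos.le, hδγ, ← mul_assoc] at h
      refine (lyapunov_le (z := (f.iter m ω (proj X), f.iter m ω (proj Y))) hp.1.le h).trans_eq ?_
      rw [ENNReal.ofReal_mul (mul_nonneg h2γ.le hpos.le), ENNReal.ofReal_mul h2γ.le,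
        ENNReal.mul_rpow_of_ne_top (ENNReal.mul_ne_top ENNReal.ofReal_ne_top
          ENNReal.ofReal_ne_top) ENNReal.ofReal_ne_top,
        ENNReal.mul_rpow_of_ne_top ENNReal.ofReal_ne_top ENNReal.ofReal_ne_top,
        ofReal_norm ((fderiv ℝ (f.liftIter m ω) X) v)]
      rfl
    refine (lintegral_mono_ae hkey).trans ?_
    rw [lintegral_const_mul' _ _ (ENNReal.mul_ne_top
      (ENNReal.rpow_ne_top_of_ne_zero (by simpa using hγ.1)
        ENNReal.ofReal_ne_top)
      (ENNReal.rpow_ne_top_of_ne_zero (by simpa using hpos)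
        ENNReal.ofReal_ne_top)), hV]
    calc ENNReal.ofReal (2 * γ) ^ (-p) * ENNReal.ofReal r ^ (-p) *
          ∫⁻ ω, ‖f.DIter m ω X v‖ₑ ^ (-p) ∂(noiseLaw P₀)
        ≤ ENNReal.ofReal (2 * γ) ^ (-p) * ENNReal.ofReal r ^ (-p) * ENNReal.ofReal γ := by
          gcongr
          exact hcontr X v hv1
      _ = (ENNReal.ofReal (2 * γ) ^ (-p) * ENNReal.ofReal γ) * ENNReal.ofReal r ^ (-p) := by ring
      _ ≤ 2⁻¹ * ENNReal.ofReal r ^ (-p) := by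
          gcongr
          -- `(2γ)⁻ᵖ γ = (2γ)¹⁻ᵖ / 2`
          rw [ENNReal.ofReal_rpow_of_pos h2γ, ← ENNReal.ofReal_mul (by positivity),
            ← ENNReal.ofReal_ofNat 2, ← ENNReal.ofReal_inv_of_pos two_pos]
          refine ENNReal.ofReal_le_ofReal ?_
          have h3 : (2 * γ) ^ (-p) * (2 * γ) ≤ 1 := by
            nth_rewrite 2 [← Real.rpow_one (2 * γ)]
            rw [← Real.rpow_add h2γ]
            exact Real.rpow_le_one h2γ.le (by linarith [hγ.2]) (by linarith [hp.2])
          linarith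
  · refine le_add_left ?_
    have hkey : ∀ᵐ ω ∂(noiseLaw P₀), lyapunov p (f.iter m ω x, f.iter m ω y) ≤
        ENNReal.ofReal (2 * γ * δ / C ^ (2 * d - 1)) ^ (-p) := by
      filter_upwards [hbound, ae_measurePreserving_iter hf, ae_injective_iter hf]
        with ω hω hpres hinj
      refine lyapunov_le hp.1.le ?_
      rw [← hδγ]
      exact div_pow_le_torusDist hd (f.contDiff_liftIter m ω)
        (f.iter_proj m ω) (hpres m) (hinj m) (fun x => (hω x).1) (fun x => (hω x).2) hC hδ0 hfar
    refine (lintegral_mono_ae hkey).trans ?_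
    simp

/-- The drift condition, iterated; the geometric series of the constants is at most `2 K`. -/
theorem lTransition_mul_le {f : C2Family d} {m : ℕ} {V : T d × T d → ℝ≥0∞} (hV : Measurable V)
    {K : ℝ≥0∞} (h : ∀ z, lTransition P₀ f m V z ≤ 2⁻¹ * V z + K) (k : ℕ) (hk : 0 < k)
    (z : T d × T d) : lTransition P₀ f (m * k) V z ≤ 2⁻¹ * V z + 2 * K := by
  induction k, hk using Nat.le_induction generalizing z with
  | base =>
    rw [Nat.succ_eq_add_one, zero_add, mul_one]
    refine (h z).trans ?_
    gcongr
    exact le_mul_of_one_le_left' one_le_two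
  | succ k hk ih =>
    rw [Nat.mul_succ, lTransition_add f _ _ hV]
    calc lTransition P₀ f (m * k) (lTransition P₀ f m V) z
        ≤ ∫⁻ ω, (2⁻¹ * V (f.iter (m * k) ω z.1, f.iter (m * k) ω z.2) + K) ∂(noiseLaw P₀) :=
          lintegral_mono fun ω => h _
      _ = 2⁻¹ * lTransition P₀ f (m * k) V z + K := by
          rw [lintegral_add_right _ measurable_const, lintegral_const_mul' _ _ (by simp)]
          simp [lTransition]
      _ ≤ 2⁻¹ * (2⁻¹ * V z + 2 * K) + K := by gcongr; exact ih z
      _ = 2⁻¹ * (2⁻¹ * V z) + 2 * K := by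
          rw [mul_add, ← mul_assoc 2⁻¹ 2 K, ENNReal.inv_mul_cancel (by simp) (by simp), one_mul,
            add_assoc, two_mul]
      _ ≤ 2⁻¹ * V z + 2 * K := by
          gcongr
          exact mul_le_of_le_one_left' (by simp)

/-! ### Harris' theorem -/

section Harris

variable {X : Type*}

/-- A function whose weighted oscillation is bounded is, up to a constant, bounded by the
weight. -/
theorem exists_enorm_sub_le {W : X → ℝ≥0∞} {g : X → ℝ} {M B : ℝ} (hM : ∀ x, |g x| ≤ M) (hB : 0 < B)
    (hosc : ∀ x y, ‖g x - g y‖ₑ ≤ ENNReal.ofReal B * (2 + (W x + W y))) :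
    ∃ c : ℝ, ∀ x, ‖g x - c‖ₑ ≤ ENNReal.ofReal B * (1 + W x) := by
  set S : Set X := {x | W x ≠ ∞} with hS
  have htop : ∀ c : ℝ, ∀ x ∉ S, ‖g x - c‖ₑ ≤ ENNReal.ofReal B * (1 + W x) := by
    intro c x hx
    have : W x = ∞ := by simpa [hS] using hx
    rw [this, add_top, ENNReal.mul_top (by simpa using hB)]
    exact le_top
  rcases S.eq_empty_or_nonempty with hSe | hSn
  · exact ⟨0, fun x => htop 0 x (by simp [hSe])⟩
  set h : X → ℝ := fun x => g x - B * (1 + (W x).toReal) with hh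
  have hreal : ∀ x ∈ S, ∀ y ∈ S, |g x - g y| ≤ B * (2 + ((W x).toReal + (W y).toReal)) := by
    intro x hx y hy
    have h1 := hosc x y
    rw [Real.enorm_eq_ofReal_abs, ← ENNReal.ofReal_toReal hx, ← ENNReal.ofReal_toReal hy,
      ← ENNReal.ofReal_add ENNReal.toReal_nonneg ENNReal.toReal_nonneg, ← ENNReal.ofReal_ofNat,
      ← ENNReal.ofReal_add (by norm_num) (by positivity), ← ENNReal.ofReal_mul hB.le,
      ENNReal.ofReal_le_ofReal_iff (by positivity)] at h1
    simpa using h1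
  have hbdd : BddAbove (h '' S) := by
    refine ⟨M, ?_⟩
    rintro _ ⟨x, -, rfl⟩
    have h1 := le_of_abs_le (hM x)
    have h2 : 0 ≤ B * (1 + (W x).toReal) := by positivity
    simp only [hh]
    linarith
  refine ⟨sSup (h '' S), fun x => ?_⟩
  by_cases hx : x ∈ S
  · have h1 : h x ≤ sSup (h '' S) := le_csSup hbdd (mem_image_of_mem _ hx)
    have h2 : sSup (h '' S) ≤ g x + B * (1 + (W x).toReal) := by
      refine csSup_le (hSn.image _) ?_
      rintro _ ⟨y, hy, rfl⟩
      have := le_of_abs_le (hreal y hy x hx)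
      simp only [hh]
      linarith
    have h3 : |g x - sSup (h '' S)| ≤ B * (1 + (W x).toReal) := by
      simp only [hh] at h1
      rw [abs_le]
      constructor <;> linarith
    rw [Real.enorm_eq_ofReal_abs, ← ENNReal.ofReal_toReal hx, ← ENNReal.ofReal_one,
      ← ENNReal.ofReal_add (by norm_num) ENNReal.toReal_nonneg, ← ENNReal.ofReal_mul hB.le]
    exact ENNReal.ofReal_le_ofReal h3
  · exact htop _ x hx

variable [MeasurableSpace X]

/-- Integrating a function against two measures of the same mass: the difference is controlled
by the weighted oscillation. -/
theorem enorm_integral_sub_integral_le {W : X → ℝ≥0∞} (hW : Measurable W) {g : X → ℝ}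
    (hg : Measurable g) {M B : ℝ} (hM : ∀ x, |g x| ≤ M) (hB : 0 < B)
    (hosc : ∀ x y, ‖g x - g y‖ₑ ≤ ENNReal.ofReal B * (2 + (W x + W y)))
    (μ μ' : Measure X) [IsFiniteMeasure μ] [IsFiniteMeasure μ'] (hμ : μ univ = μ' univ) :
    ‖∫ x, g x ∂μ - ∫ x, g x ∂μ'‖ₑ ≤
      ENNReal.ofReal B * (2 * μ univ + (∫⁻ x, W x ∂μ + ∫⁻ x, W x ∂μ')) := by
  obtain ⟨c, hc⟩ := exists_enorm_sub_le hM hB hosc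
  have hint : ∀ (η : Measure X) [IsFiniteMeasure η], Integrable g η := fun η _ =>
    Integrable.of_bound hg.aestronglyMeasurable M (Eventually.of_forall hM)
  have hsub : ∀ (η : Measure X) [IsFiniteMeasure η],
      ∫ x, (g x - c) ∂η = ∫ x, g x ∂η - η.real univ * c := fun η _ => by
    rw [integral_sub (hint η) (integrable_const c), integral_const, smul_eq_mul]
  have hle : ∀ (η : Measure X) [IsFiniteMeasure η],
      ‖∫ x, (g x - c) ∂η‖ₑ ≤ ENNReal.ofReal B * (η univ + ∫⁻ x, W x ∂η) := fun η _ => by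
    refine (enorm_integral_le_lintegral_enorm _).trans ((lintegral_mono hc).trans_eq ?_)
    rw [lintegral_const_mul' _ _ ENNReal.ofReal_ne_top, lintegral_add_right _ hW, lintegral_const,
      one_mul]
  have heq : ∫ x, g x ∂μ - ∫ x, g x ∂μ' = ∫ x, (g x - c) ∂μ - ∫ x, (g x - c) ∂μ' := by
    rw [hsub, hsub, measureReal_def, measureReal_def, hμ]
    ring
  rw [heq]
  calc ‖∫ x, (g x - c) ∂μ - ∫ x, (g x - c) ∂μ'‖ₑ
      ≤ ‖∫ x, (g x - c) ∂μ‖ₑ + ‖∫ x, (g x - c) ∂μ'‖ₑ := enorm_sub_le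
    _ ≤ ENNReal.ofReal B * (μ univ + ∫⁻ x, W x ∂μ) +
        ENNReal.ofReal B * (μ' univ + ∫⁻ x, W x ∂μ') := add_le_add (hle μ) (hle μ')
    _ = _ := by rw [← hμ]; ring

/-- **Harris' theorem**, one step, in the form of Hairer and Mattingly. The kernel `κ` satisfies a
drift condition for `V` and a minorization on the sublevel set `{V ≤ 32 K}`; then it contracts the
oscillation weighted by `1 + β V`, where `β = α / (8 K)`. -/
theorem harris_contraction {κ : X → Measure X} [∀ x, IsProbabilityMeasure (κ x)] {V : X → ℝ≥0∞}
    (hV : Measurable V) {K α : ℝ} (hK : 0 < K) (hα : α ∈ Ioo (0 : ℝ) 1)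
    (hdrift : ∀ x, ∫⁻ y, V y ∂(κ x) ≤ 2⁻¹ * V x + 2 * ENNReal.ofReal K)
    {ν : Measure X} [IsProbabilityMeasure ν]
    (hmin : ∀ x, V x ≤ ENNReal.ofReal (32 * K) → ENNReal.ofReal α • ν ≤ κ x)
    {g : X → ℝ} (hg : Measurable g) {M B : ℝ} (hM : ∀ x, |g x| ≤ M) (hB : 0 < B)
    (hosc : ∀ x y, ‖g x - g y‖ₑ ≤ ENNReal.ofReal B *
      (2 + (ENNReal.ofReal (α / (8 * K)) * V x + ENNReal.ofReal (α / (8 * K)) * V y))) (x y : X) :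
    ‖∫ z, g z ∂(κ x) - ∫ z, g z ∂(κ y)‖ₑ ≤ ENNReal.ofReal (B * (1 - α / 8)) *
      (2 + (ENNReal.ofReal (α / (8 * K)) * V x + ENNReal.ofReal (α / (8 * K)) * V y)) := by
  obtain ⟨hα0, hα1⟩ := hα
  set β := α / (8 * K) with hβ
  have hβ0 : 0 < β := by positivity
  have hβK : β * K = α / 8 := by rw [hβ]; field_simp
  have hρ : 0 < B * (1 - α / 8) := mul_pos hB (by linarith)
  have hWm : Measurable fun x => ENNReal.ofReal β * V x := hV.const_mul _
  -- the case that one of the weights is infinite is trivial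
  by_cases hx : V x = ∞
  · rw [hx, ENNReal.mul_top (by simpa using hβ0), top_add, add_top,
      ENNReal.mul_top (by simpa using hρ)]
    exact le_top
  by_cases hy : V y = ∞
  · rw [hy, ENNReal.mul_top (by simpa using hβ0), add_top, add_top,
      ENNReal.mul_top (by simpa using hρ)]
    exact le_top
  obtain ⟨a, ha, hxa⟩ : ∃ a : ℝ, 0 ≤ a ∧ V x = ENNReal.ofReal a :=
    ⟨(V x).toReal, ENNReal.toReal_nonneg, (ENNReal.ofReal_toReal hx).symm⟩
  obtain ⟨b, hb, hyb⟩ : ∃ b : ℝ, 0 ≤ b ∧ V y = ENNReal.ofReal b :=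
    ⟨(V y).toReal, ENNReal.toReal_nonneg, (ENNReal.ofReal_toReal hy).symm⟩
  have hdrift' : ∀ (z : X) (t : ℝ), 0 ≤ t → V z = ENNReal.ofReal t →
      ENNReal.ofReal β * ∫⁻ y, V y ∂(κ z) ≤ ENNReal.ofReal (β * (t / 2 + 2 * K)) := by
    intro z t ht hzt
    rw [ENNReal.ofReal_mul hβ0.le]
    gcongr
    refine (hdrift z).trans_eq ?_
    rw [hzt, ENNReal.ofReal_add (by positivity) (by positivity), div_eq_inv_mul,
      ENNReal.ofReal_mul (by norm_num), ENNReal.ofReal_mul (by norm_num),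
      ENNReal.ofReal_inv_of_pos two_pos, ENNReal.ofReal_ofNat]
  have hrhs : ENNReal.ofReal (B * (1 - α / 8)) *
      (2 + (ENNReal.ofReal β * V x + ENNReal.ofReal β * V y)) =
      ENNReal.ofReal (B * (1 - α / 8) * (2 + (β * a + β * b))) := by
    rw [hxa, hyb, ENNReal.ofReal_mul hρ.le, ENNReal.ofReal_add two_pos.le (by positivity),
      ENNReal.ofReal_add (by positivity) (by positivity), ENNReal.ofReal_mul hβ0.le,
      ENNReal.ofReal_mul hβ0.le, ENNReal.ofReal_ofNat]
  rw [hrhs]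
  -- if both points lie in the small set, the common component `α ν` cancels; otherwise the drift
  -- alone contracts, because the constant `2 K` is small compared to `V x + V y`
  rcases le_or_gt (a + b) (32 * K) with hsmall | hlarge
  · have hmx : ENNReal.ofReal α • ν ≤ κ x :=
      hmin x (hxa ▸ ENNReal.ofReal_le_ofReal (by linarith))
    have hmy : ENNReal.ofReal α • ν ≤ κ y :=
      hmin y (hyb ▸ ENNReal.ofReal_le_ofReal (by linarith))
    have : IsFiniteMeasure (ENNReal.ofReal α • ν) := ν.smul_finite ENNReal.ofReal_ne_top
    have hdecomp : ∀ z, ENNReal.ofReal α • ν ≤ κ z →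
        ∫ w, g w ∂(κ z) = ∫ w, g w ∂(κ z - ENNReal.ofReal α • ν) +
          ∫ w, g w ∂(ENNReal.ofReal α • ν) := by
      intro z hz
      conv_lhs => rw [← Measure.sub_add_cancel_of_le hz]
      refine integral_add_measure ?_ ?_ <;>
      exact Integrable.of_bound hg.aestronglyMeasurable M (Eventually.of_forall hM)
    have hmass : ∀ z, ENNReal.ofReal α • ν ≤ κ z →
        (κ z - ENNReal.ofReal α • ν) univ = ENNReal.ofReal (1 - α) := by
      intro z hz
      rw [Measure.sub_apply MeasurableSet.univ hz]
      simp [ENNReal.ofReal_sub _ hα0.le]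
    rw [hdecomp x hmx, hdecomp y hmy, add_sub_add_right_eq_sub]
    refine (enorm_integral_sub_integral_le hWm hg hM hB hosc _ _
      ((hmass x hmx).trans (hmass y hmy).symm)).trans ?_
    rw [hmass x hmx, lintegral_const_mul _ hV, lintegral_const_mul _ hV]
    have hx2 := hdrift' x a ha hxa
    have hy2 := hdrift' y b hb hyb
    have hx3 : ∫⁻ w, V w ∂(κ x - ENNReal.ofReal α • ν) ≤ ∫⁻ w, V w ∂(κ x) :=
      lintegral_mono' Measure.sub_le le_rfl
    have hy3 : ∫⁻ w, V w ∂(κ y - ENNReal.ofReal α • ν) ≤ ∫⁻ w, V w ∂(κ y) :=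
      lintegral_mono' Measure.sub_le le_rfl
    calc ENNReal.ofReal B * (2 * ENNReal.ofReal (1 - α) +
          (ENNReal.ofReal β * ∫⁻ w, V w ∂(κ x - ENNReal.ofReal α • ν) +
            ENNReal.ofReal β * ∫⁻ w, V w ∂(κ y - ENNReal.ofReal α • ν)))
        ≤ ENNReal.ofReal B * (2 * ENNReal.ofReal (1 - α) +
          (ENNReal.ofReal (β * (a / 2 + 2 * K)) + ENNReal.ofReal (β * (b / 2 + 2 * K)))) := by
          gcongr
          · exact (mul_le_mul_right hx3 _).trans hx2
          · exact (mul_le_mul_right hy3 _).trans hy2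
      _ = ENNReal.ofReal (B * (2 * (1 - α) + (β * (a / 2 + 2 * K) + β * (b / 2 + 2 * K)))) := by
          have h1α : 0 ≤ 1 - α := by linarith
          rw [ENNReal.ofReal_mul hB.le, ENNReal.ofReal_add (by positivity) (by positivity),
            ENNReal.ofReal_add (by positivity) (by positivity), ENNReal.ofReal_mul two_pos.le,
            ENNReal.ofReal_ofNat]
      _ ≤ ENNReal.ofReal (B * (1 - α / 8) * (2 + (β * a + β * b))) := by
          refine ENNReal.ofReal_le_ofReal ?_
          rw [mul_assoc]
          refine mul_le_mul_of_nonneg_left ?_ hB.le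
          have h1 : 0 ≤ β * (a + b) := by positivity
          nlinarith [mul_nonneg (sub_nonneg.2 hα1.le) h1]
  · refine (enorm_integral_sub_integral_le hWm hg hM hB hosc (κ x) (κ y) (by simp)).trans ?_
    rw [lintegral_const_mul _ hV, lintegral_const_mul _ hV, measure_univ, mul_one]
    calc ENNReal.ofReal B * (2 + (ENNReal.ofReal β * ∫⁻ w, V w ∂(κ x) +
            ENNReal.ofReal β * ∫⁻ w, V w ∂(κ y)))
        ≤ ENNReal.ofReal B * (2 +
          (ENNReal.ofReal (β * (a / 2 + 2 * K)) + ENNReal.ofReal (β * (b / 2 + 2 * K)))) := by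
          gcongr
          · exact hdrift' x a ha hxa
          · exact hdrift' y b hb hyb
      _ = ENNReal.ofReal (B * (2 + (β * (a / 2 + 2 * K) + β * (b / 2 + 2 * K)))) := by
          rw [ENNReal.ofReal_mul hB.le, ENNReal.ofReal_add (by positivity) (by positivity),
            ENNReal.ofReal_add (by positivity) (by positivity), ENNReal.ofReal_ofNat]
      _ ≤ ENNReal.ofReal (B * (1 - α / 8) * (2 + (β * a + β * b))) := by
          refine ENNReal.ofReal_le_ofReal ?_
          rw [mul_assoc]
          refine mul_le_mul_of_nonneg_left ?_ hB.le
          have h1 : 4 * α ≤ β * (a + b) := by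
            have := mul_le_mul_of_nonneg_left hlarge.le hβ0.le
            nlinarith
          nlinarith [mul_nonneg (sub_nonneg.2 hα1.le) (h1.trans' (by positivity : 0 ≤ 4 * α))]

end Harris

/-- Geometric ergodicity of the two-point process, averaged over the initial condition. -/
theorem lintegral_enorm_transition_le {f : C2Family d} (hf : StandingHypothesis P₀ f)
    {L : ℕ} {V : T d × T d → ℝ≥0∞} (hV : Measurable V) {K α : ℝ} (hK : 0 < K)
    (hα : α ∈ Ioo (0 : ℝ) 1)
    (hdrift : ∀ z, lTransition P₀ f L V z ≤ 2⁻¹ * V z + 2 * ENNReal.ofReal K)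
    {ν : Measure (T d × T d)} [IsProbabilityMeasure ν]
    (hmin : ∀ z, V z ≤ ENNReal.ofReal (32 * K) →
      ENNReal.ofReal α • ν ≤ twoPoint P₀ f L z.1 z.2)
    {g : T d × T d → ℝ} (hg : Measurable g) (hM : ∀ z, |g z| ≤ 1)
    (hmean : ∫ z, g z ∂((leb d).prod (leb d)) = 0) (l : ℕ) :
    ∫⁻ z, ‖transition P₀ f (L * l) g z‖ₑ ∂((leb d).prod (leb d)) ≤
      ENNReal.ofReal ((1 - α / 8) ^ l) * (2 + 2 * (ENNReal.ofReal (α / (8 * K)) *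
        ∫⁻ z, V z ∂((leb d).prod (leb d)))) := by
  set β := α / (8 * K) with hβ
  have hρ : 0 < 1 - α / 8 := by linarith [hα.2]
  have hosc : ∀ (l : ℕ) (z w : T d × T d),
      ‖transition P₀ f (L * l) g z - transition P₀ f (L * l) g w‖ₑ ≤
        ENNReal.ofReal ((1 - α / 8) ^ l) *
          (2 + (ENNReal.ofReal β * V z + ENNReal.ofReal β * V w)) := by
    intro l
    induction l with
    | zero =>
      intro z w
      rw [pow_zero, ENNReal.ofReal_one, one_mul]
      refine le_add_right (enorm_sub_le.trans ?_)
      rw [← one_add_one_eq_two]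
      refine add_le_add ?_ ?_ <;>
      · rw [Real.enorm_eq_ofReal_abs, ENNReal.ofReal_le_one]
        exact abs_transition_le f _ hM _
    | succ l ih =>
      have hstep : ∀ z, transition P₀ f (L * (l + 1)) g z =
          ∫ w, transition P₀ f (L * l) g w ∂(twoPoint P₀ f L z.1 z.2) := by
        intro z
        rw [mul_add, mul_one, add_comm, transition_add f _ _ hg hM,
          transition_eq_integral_twoPoint f L (measurable_transition f _ hg)]
      intro z w
      rw [hstep z, hstep w, pow_succ]
      exact harris_contraction (κ := fun z => twoPoint P₀ f L z.1 z.2) hV hK hα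
        (fun z => by rw [← lTransition_eq_lintegral_twoPoint f L hV]; exact hdrift z) hmin
        (measurable_transition f _ hg) (abs_transition_le f _ hM) (pow_pos hρ l) ih z w
  have hint : Integrable (transition P₀ f (L * l) g) ((leb d).prod (leb d)) :=
    Integrable.of_bound (measurable_transition f _ hg).aestronglyMeasurable 1
      (Eventually.of_forall (abs_transition_le f _ hM))
  have hmean' : ∫ z, transition P₀ f (L * l) g z ∂((leb d).prod (leb d)) = 0 := by
    rw [integral_transition hf _ hg hM, hmean]
  set I := ∫⁻ z, V z ∂((leb d).prod (leb d)) with hI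
  have hpt : ∀ z, ‖transition P₀ f (L * l) g z‖ₑ ≤ ENNReal.ofReal ((1 - α / 8) ^ l) *
      (2 + (ENNReal.ofReal β * V z + ENNReal.ofReal β * I)) := by
    intro z
    have h1 : transition P₀ f (L * l) g z = ∫ w, (transition P₀ f (L * l) g z -
        transition P₀ f (L * l) g w) ∂((leb d).prod (leb d)) := by
      rw [integral_sub (integrable_const _) hint, hmean']
      simp
    rw [h1]
    refine (enorm_integral_le_lintegral_enorm _).trans ((lintegral_mono (hosc l z)).trans_eq ?_)
    rw [lintegral_const_mul' _ _ ENNReal.ofReal_ne_top, lintegral_add_left measurable_const,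
      lintegral_add_left measurable_const, lintegral_const_mul _ hV]
    simp [hI]
  refine (lintegral_mono hpt).trans_eq ?_
  rw [lintegral_const_mul' _ _ ENNReal.ofReal_ne_top, lintegral_add_left measurable_const,
    lintegral_add_right _ measurable_const, lintegral_const_mul _ hV]
  simp only [lintegral_const, measure_univ, mul_one]
  ring

/-! ### Integrability of the Lyapunov function -/

theorem lintegral_Ioc_enorm_rpow_lt_top {p : ℝ} (hp : p < 1) :
    ∫⁻ t in Ioc (-π) π, ‖t‖ₑ ^ (-p) < ∞ := by
  have hpos : IntervalIntegrable (fun t : ℝ => t ^ (-p)) volume 0 π :=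
    intervalIntegral.intervalIntegrable_rpow' (by linarith)
  have hneg : IntervalIntegrable (fun t : ℝ => (-t) ^ (-p)) volume (-π) 0 := by
    simpa using ((IntervalIntegrable.iff_comp_neg (by simp)).1 hpos).symm
  rw [intervalIntegrable_iff_integrableOn_Ioo_of_le Real.pi_pos.le] at hpos
  rw [intervalIntegrable_iff_integrableOn_Ioo_of_le (by linarith [Real.pi_pos])] at hneg
  have h1 : ∫⁻ t in Ioo 0 π, ‖t‖ₑ ^ (-p) < ∞ := by
    refine lt_of_eq_of_lt (setLIntegral_congr_fun measurableSet_Ioo fun t ht => ?_) hpos.2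
    simp only
    rw [Real.enorm_of_nonneg ht.1.le, ENNReal.ofReal_rpow_of_pos ht.1,
      Real.enorm_of_nonneg (Real.rpow_nonneg ht.1.le _)]
  have h2 : ∫⁻ t in Ioo (-π) 0, ‖t‖ₑ ^ (-p) < ∞ := by
    refine lt_of_eq_of_lt (setLIntegral_congr_fun measurableSet_Ioo fun t ht => ?_) hneg.2
    have h0 : 0 < -t := by linarith [ht.2]
    simp only
    rw [← enorm_neg, Real.enorm_of_nonneg h0.le, ENNReal.ofReal_rpow_of_pos h0,
      Real.enorm_of_nonneg (Real.rpow_nonneg h0.le _)]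
  have hsub : Ioc (-π) π ⊆ (Ioo (-π) 0 ∪ Ioo 0 π) ∪ {0, π} := by
    rintro t ⟨h3, h4⟩
    rcases lt_trichotomy t 0 with h | h | h
    · exact Or.inl (Or.inl ⟨h3, h⟩)
    · exact Or.inr (Or.inl h)
    · rcases h4.eq_or_lt with h5 | h5
      · exact Or.inr (Or.inr h5)
      · exact Or.inl (Or.inr ⟨h, h5⟩)
  have h3 : ∫⁻ t in ({0, π} : Set ℝ), ‖t‖ₑ ^ (-p) = 0 :=
    setLIntegral_measure_zero _ _ ((Set.toFinite _).measure_zero _)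
  refine (lintegral_mono_set hsub).trans_lt ?_
  refine (lintegral_union_le _ _ _).trans_lt ?_
  rw [h3, add_zero]
  exact (lintegral_union_le _ _ _).trans_lt (ENNReal.add_lt_top.2 ⟨h2, h1⟩)

theorem lintegral_addCircle_enorm_rpow_lt_top {p : ℝ} (hp : p < 1) :
    ∫⁻ t : AddCircle (2 * π), ‖t‖ₑ ^ (-p) ∂AddCircle.haarAddCircle < ∞ := by
  have hm : Measurable fun t : AddCircle (2 * π) => ‖t‖ₑ ^ (-p) :=
    continuous_enorm.measurable.pow_const _
  have h := (AddCircle.measurePreserving_mk (2 * π) (-π)).lintegral_comp hm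
  rw [AddCircle.volume_eq_smul_haarAddCircle, lintegral_smul_measure] at h
  have h2 : ∫⁻ t in Ioc (-π) (-π + 2 * π), ‖(t : AddCircle (2 * π))‖ₑ ^ (-p) < ∞ := by
    rw [show -π + 2 * π = π by ring]
    refine lt_of_eq_of_lt (setLIntegral_congr_fun measurableSet_Ioc fun t ht => ?_)
      (lintegral_Ioc_enorm_rpow_lt_top hp)
    have : ‖(t : AddCircle (2 * π))‖ = |t| := by
      rw [AddCircle.norm_coe_eq_abs_iff _ Real.two_pi_pos.ne', abs_of_pos Real.two_pi_pos,
        mul_div_cancel_left₀ _ two_ne_zero]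
      exact abs_le.2 ⟨ht.1.le, ht.2⟩
    rw [← ofReal_norm, this, Real.enorm_eq_ofReal_abs]
  rw [h] at h2
  refine lt_top_iff_ne_top.2 fun htop => ?_
  rw [htop, smul_eq_mul, ENNReal.mul_top (by simpa using Real.pi_pos)] at h2
  exact lt_irrefl _ h2

theorem lintegral_lyapunov_lt_top (hd : 0 < d) {p : ℝ} (hp : p ∈ Ioo (0 : ℝ) 1) :
    ∫⁻ z, lyapunov (d := d) p z ∂((leb d).prod (leb d)) < ∞ := by
  let i₀ : Fin d := ⟨0, hd⟩
  have hle : ∀ z : T d × T d, lyapunov p z ≤ ‖z.1 i₀ - z.2 i₀‖ₑ ^ (-p) := by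
    intro z
    have := lyapunov_le hp.1.le (dist_apply_le_torusDist z.1 z.2 i₀)
    rwa [dist_eq_norm, ofReal_norm] at this
  have hm : Measurable fun z : T d × T d => ‖z.1 i₀ - z.2 i₀‖ₑ ^ (-p) := by
    have : Continuous fun z : T d × T d => ‖z.1 i₀ - z.2 i₀‖ₑ := by fun_prop
    exact this.measurable.pow_const _
  have hm1 : Measurable fun t : AddCircle (2 * π) => ‖t‖ₑ ^ (-p) :=
    continuous_enorm.measurable.pow_const _
  refine (lintegral_mono hle).trans_lt ?_
  rw [lintegral_prod _ hm.aemeasurable]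
  have hinner : ∀ x : T d, ∫⁻ y : T d, ‖x i₀ - y i₀‖ₑ ^ (-p) ∂(leb d) =
      ∫⁻ t : AddCircle (2 * π), ‖t‖ₑ ^ (-p) ∂AddCircle.haarAddCircle := by
    intro x
    have he : MeasurePreserving (Function.eval i₀) (leb d)
        (AddCircle.haarAddCircle (T := 2 * π)) :=
      measurePreserving_eval (fun _ : Fin d => AddCircle.haarAddCircle (T := 2 * π)) i₀
    have h1 := he.lintegral_comp (f := fun t => ‖x i₀ - t‖ₑ ^ (-p))
      (hm1.comp (measurable_const.sub measurable_id))
    exact h1.trans (lintegral_sub_left_eq_self (fun t : AddCircle (2 * π) => ‖t‖ₑ ^ (-p)) (x i₀))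
  rw [lintegral_congr hinner, lintegral_const, measure_univ, mul_one]
  exact lintegral_addCircle_enorm_rpow_lt_top hp.2

/-! ### Correlations of Fourier modes -/

/-- The Fourier mode `x ↦ e^{i n·x}`. -/
noncomputable def mode (n : Fin d → ℤ) (x : T d) : ℂ := ∏ i, fourier (n i) (x i)

theorem continuous_mode (n : Fin d → ℤ) : Continuous (mode n) := by
  unfold mode
  fun_prop

theorem norm_mode (n : Fin d → ℤ) (x : T d) : ‖mode n x‖ = 1 := by
  rw [mode, norm_prod]
  exact Finset.prod_eq_one fun i _ => Circle.norm_coe _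

theorem integral_mode {n : Fin d → ℤ} (hn : n ≠ 0) : ∫ x, mode n x ∂(leb d) = 0 := by
  obtain ⟨i, hi⟩ := Function.ne_iff.1 hn
  have h1 : ∫ t : AddCircle (2 * π), fourier (n i) t ∂AddCircle.haarAddCircle = 0 :=
    integral_eq_zero_of_add_right_eq_neg (fourier_add_half_inv_index hi Real.two_pi_pos)
  unfold mode leb
  rw [integral_fintype_prod_eq_prod (𝕜 := ℂ) (fun i (t : AddCircle (2 * π)) => fourier (n i) t)]
  exact Finset.prod_eq_zero (Finset.mem_univ i) h1

/-- The correlation `∫ e^{i a·x} e^{i b·fⁿ(x)} dx` of two Fourier modes. -/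
noncomputable def modeCorr (f : C2Family d) (n : ℕ) (a b : Fin d → ℤ) (ω : ℕ → E d) : ℂ :=
  ∫ x, mode a x * mode b (f.iter n ω x) ∂(leb d)

theorem measurable_modeCorr (f : C2Family d) (n : ℕ) (a b : Fin d → ℤ) :
    Measurable (modeCorr f n a b) := by
  have h : Continuous fun z : (ℕ → E d) × T d => mode a z.2 * mode b (f.iter n z.1 z.2) :=
    ((continuous_mode a).comp continuous_snd).mul ((continuous_mode b).comp (f.continuous_iter n))
  exact h.measurable.stronglyMeasurable.integral_prod_right.measurable

/-- The mean square of a correlation is an average of two-point transitions: expand the square as a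
double integral and apply Fubini's theorem. -/
theorem lintegral_enorm_modeCorr_sq_le (f : C2Family d) (n : ℕ) (a b : Fin d → ℤ) :
    ∫⁻ ω, ‖modeCorr f n a b ω‖ₑ ^ 2 ∂(noiseLaw P₀) ≤
      ∫⁻ z, ‖transition P₀ f n (fun z => (mode b z.1 * star (mode b z.2)).re) z‖ₑ
        ∂((leb d).prod (leb d)) +
      ∫⁻ z, ‖transition P₀ f n (fun z => (mode b z.1 * star (mode b z.2)).im) z‖ₑ
        ∂((leb d).prod (leb d)) := by
  set G : T d × T d → ℂ := fun z => mode b z.1 * star (mode b z.2) with hG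
  set H : T d × T d → ℂ := fun z => mode a z.1 * star (mode a z.2) with hH
  have hGc : Continuous G := ((continuous_mode b).comp continuous_fst).mul
    ((continuous_mode b).comp continuous_snd).star
  have hHc : Continuous H := ((continuous_mode a).comp continuous_fst).mul
    ((continuous_mode a).comp continuous_snd).star
  have hG1 : ∀ z, ‖G z‖ = 1 := fun z => by simp [hG, norm_mode]
  have hH1 : ∀ z, ‖H z‖ = 1 := fun z => by simp [hH, norm_mode]
  have hsq : ∀ ω, ((‖modeCorr f n a b ω‖ ^ 2 : ℝ) : ℂ) =
      ∫ z, H z * G (f.iter n ω z.1, f.iter n ω z.2) ∂((leb d).prod (leb d)) := by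
    intro ω
    have h1 : ((‖modeCorr f n a b ω‖ ^ 2 : ℝ) : ℂ) =
        modeCorr f n a b ω * star (modeCorr f n a b ω) := by
      rw [Complex.star_def, Complex.mul_conj, Complex.normSq_eq_norm_sq]
    rw [h1, modeCorr, Complex.star_def, ← integral_conj, ← integral_prod_mul]
    refine integral_congr_ae (Eventually.of_forall fun z => ?_)
    simp only [hG, hH, map_mul, Complex.star_def]
    ring
  have hjoint : Continuous fun w : (ℕ → E d) × (T d × T d) =>
      H w.2 * G (f.iter n w.1 w.2.1, f.iter n w.1 w.2.2) :=
    (hHc.comp continuous_snd).mul (hGc.comp (f.continuous_iter_pair n))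
  have hGω : ∀ z : T d × T d, Integrable
      (fun ω => G (f.iter n ω z.1, f.iter n ω z.2)) (noiseLaw P₀) := fun z =>
    Integrable.of_bound (hGc.measurable.comp
      (f.measurable_iter_pair_left n z.1 z.2)).aestronglyMeasurable 1
      (Eventually.of_forall fun _ => (hG1 _).le)
  have hmain : ((∫ ω, ‖modeCorr f n a b ω‖ ^ 2 ∂(noiseLaw P₀) : ℝ) : ℂ) =
      ∫ z, H z * ∫ ω, G (f.iter n ω z.1, f.iter n ω z.2) ∂(noiseLaw P₀)
        ∂((leb d).prod (leb d)) := by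
    rw [← integral_complex_ofReal]
    rw [integral_congr_ae (Eventually.of_forall hsq), integral_integral_swap]
    · simp only [integral_const_mul]
    · exact Integrable.of_bound hjoint.aestronglyMeasurable 1
        (Eventually.of_forall fun w => by
          change ‖H w.2 * G _‖ ≤ 1
          rw [norm_mul, hG1, hH1, mul_one])
  have hcorr1 : ∀ ω, ‖modeCorr f n a b ω‖ ≤ 1 := fun ω => by
    have := norm_integral_le_of_norm_le_const (μ := leb d) (C := 1)
      (f := fun x => mode a x * mode b (f.iter n ω x))
      (Eventually.of_forall fun x => by simp [norm_mode])
    simpa [modeCorr] using this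
  have hint : Integrable (fun ω => ‖modeCorr f n a b ω‖ ^ 2) (noiseLaw P₀) :=
    Integrable.of_bound ((measurable_modeCorr f n a b).norm.pow_const 2).aestronglyMeasurable 1
      (Eventually.of_forall fun ω => by
        rw [norm_pow, norm_norm]
        exact pow_le_one₀ (norm_nonneg _) (hcorr1 ω))
  have h1 : ∫⁻ ω, ‖modeCorr f n a b ω‖ₑ ^ 2 ∂(noiseLaw P₀) =
      ‖((∫ ω, ‖modeCorr f n a b ω‖ ^ 2 ∂(noiseLaw P₀) : ℝ) : ℂ)‖ₑ := by
    have h0 : 0 ≤ ∫ ω, ‖modeCorr f n a b ω‖ ^ 2 ∂(noiseLaw P₀) :=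
      integral_nonneg fun _ => by positivity
    rw [← ofReal_norm, Complex.norm_real, Real.norm_of_nonneg h0,
      ofReal_integral_eq_lintegral_ofReal hint (Eventually.of_forall fun _ => by positivity)]
    refine lintegral_congr fun ω => ?_
    rw [← ofReal_norm, ENNReal.ofReal_pow (norm_nonneg _)]
  rw [h1, hmain]
  refine (enorm_integral_le_lintegral_enorm _).trans ?_
  have hre : Measurable fun z => (G z).re := Complex.measurable_re.comp hGc.measurable
  rw [← lintegral_add_left (measurable_transition f n hre).enorm]
  refine lintegral_mono fun z => ?_
  have h2 : ∫ ω, G (f.iter n ω z.1, f.iter n ω z.2) ∂(noiseLaw P₀) =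
      (transition P₀ f n (fun z => (G z).re) z : ℂ) +
        (transition P₀ f n (fun z => (G z).im) z : ℂ) * Complex.I := by
    rw [transition, transition]
    exact (integral_re_add_im (hGω z)).symm
  rw [h2, enorm_mul, ← ofReal_norm (H z), hH1, ENNReal.ofReal_one, one_mul]
  refine (enorm_add_le _ _).trans ?_
  rw [enorm_mul, ← ofReal_norm Complex.I, Complex.norm_I, ENNReal.ofReal_one, mul_one]
  have he : ∀ t : ℝ, ‖(t : ℂ)‖ₑ = ‖t‖ₑ := fun t => by
    rw [← ofReal_norm, Complex.norm_real, ofReal_norm]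
  rw [he, he]

/-! ### Mean-square decay of correlations -/

/-- Contraction in steps of length `L` gives exponential decay at all times; the factor `2` accounts
for the incomplete last step. -/
theorem one_sub_pow_div_le_exp {α : ℝ} (hα : α ∈ Ioo (0 : ℝ) 1) {L : ℕ} (hL : 0 < L) (n : ℕ) :
    (1 - α / 8) ^ (n / L) ≤ 2 * exp (-(α / (8 * L)) * n) := by
  have hL' : (0 : ℝ) < L := by exact_mod_cast hL
  have h1 : (1 - α / 8) ^ (n / L) ≤ exp (-(α / 8)) ^ (n / L) := by
    refine pow_le_pow_left₀ (by linarith [hα.2]) ?_ _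
    linarith [Real.add_one_le_exp (-(α / 8))]
  have h2 : (n : ℝ) / L ≤ (n / L : ℕ) + 1 := by
    rw [div_le_iff₀ hL']
    have h0 := Nat.lt_mul_div_succ n hL
    have h3 : (n : ℝ) < L * ((n / L : ℕ) + 1) := by exact_mod_cast h0
    linarith
  have h4 : exp (-(α / 8)) ^ (n / L) ≤ exp (1 / 8) * exp (-(α / (8 * L)) * n) := by
    rw [← Real.exp_nat_mul, ← Real.exp_add]
    refine Real.exp_le_exp.2 ?_
    have h5 : α / (8 * L) * n = α / 8 * (n / L) := by field_simp
    have h6 := mul_le_mul_of_nonneg_left h2 (by linarith [hα.1] : 0 ≤ α / 8)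
    rw [neg_mul, h5]
    linarith [hα.2]
  have h7 : exp (1 / 8) ≤ 2 := by
    have := Real.exp_one_lt_d9
    have h8 : exp (1 / 8) ^ 8 ≤ 2 ^ 8 := by
      rw [← Real.exp_nat_mul]
      norm_num
      linarith
    exact le_of_pow_le_pow_left₀ (by norm_num) (by norm_num) h8
  exact h1.trans (h4.trans (mul_le_mul_of_nonneg_right h7 (Real.exp_pos _).le))

/-- Mean-square decay of the correlations of Fourier modes. -/
theorem lintegral_enorm_modeCorr_sq_le_exp {f : C2Family d} (hf : StandingHypothesis P₀ f)
    {L : ℕ} (hL : 0 < L) {V : T d × T d → ℝ≥0∞} (hV : Measurable V) {K α : ℝ} (hK : 1 ≤ K)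
    (hα : α ∈ Ioo (0 : ℝ) 1)
    (hdrift : ∀ z, lTransition P₀ f L V z ≤ 2⁻¹ * V z + 2 * ENNReal.ofReal K)
    {ν : Measure (T d × T d)} [IsProbabilityMeasure ν]
    (hmin : ∀ z, V z ≤ ENNReal.ofReal (32 * K) →
      ENNReal.ofReal α • ν ≤ twoPoint P₀ f L z.1 z.2)
    (n : ℕ) (a : Fin d → ℤ) {b : Fin d → ℤ} (hb : b ≠ 0) :
    ∫⁻ ω, ‖modeCorr f n a b ω‖ₑ ^ 2 ∂(noiseLaw P₀) ≤
      ENNReal.ofReal (exp (-(α / (8 * L)) * n)) *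
        (8 * (1 + ∫⁻ z, V z ∂((leb d).prod (leb d)))) := by
  set I := ∫⁻ z, V z ∂((leb d).prod (leb d)) with hI
  set G : T d × T d → ℂ := fun z => mode b z.1 * star (mode b z.2) with hG
  have hGc : Continuous G := ((continuous_mode b).comp continuous_fst).mul
    ((continuous_mode b).comp continuous_snd).star
  have hG1 : ∀ z, ‖G z‖ = 1 := fun z => by simp [hG, norm_mode]
  have hGi : Integrable G ((leb d).prod (leb d)) :=
    Integrable.of_bound hGc.aestronglyMeasurable 1 (Eventually.of_forall fun z => (hG1 z).le)
  have hG0 : ∫ z, G z ∂((leb d).prod (leb d)) = 0 := by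
    have := integral_prod_mul (μ := leb d) (ν := leb d) (mode b) (fun y => star (mode b y))
    rw [integral_mode hb, zero_mul] at this
    exact this
  have key : ∀ g : T d × T d → ℝ, Measurable g → (∀ z, |g z| ≤ 1) →
      ∫ z, g z ∂((leb d).prod (leb d)) = 0 →
      ∫⁻ z, ‖transition P₀ f n g z‖ₑ ∂((leb d).prod (leb d)) ≤
        ENNReal.ofReal (exp (-(α / (8 * L)) * n)) * (4 * (1 + I)) := by
    intro g hg hg1 hg0
    -- the last `n % L` steps are absorbed into the observable
    have hn : L * (n / L) + n % L = n := Nat.div_add_mod n L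
    have h1 := lintegral_enorm_transition_le hf hV (one_pos.trans_le hK) hα hdrift hmin
      (measurable_transition f (n % L) hg) (abs_transition_le f (n % L) hg1)
      ((integral_transition hf (n % L) hg hg1).trans hg0) (n / L)
    have h2 : ∀ z, transition P₀ f n g z =
        transition P₀ f (L * (n / L)) (transition P₀ f (n % L) g) z := fun z => by
      rw [← transition_add f _ _ hg hg1, hn]
    simp only [h2]
    refine h1.trans ?_
    have h3 : ENNReal.ofReal (α / (8 * K)) ≤ 1 := by
      rw [ENNReal.ofReal_le_one, div_le_one (by linarith)]
      linarith [hα.2]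
    calc ENNReal.ofReal ((1 - α / 8) ^ (n / L)) * (2 + 2 * (ENNReal.ofReal (α / (8 * K)) * I))
        ≤ ENNReal.ofReal (2 * exp (-(α / (8 * L)) * n)) * (2 + 2 * (1 * I)) := by
          gcongr
          exact one_sub_pow_div_le_exp hα hL n
      _ = _ := by
          rw [ENNReal.ofReal_mul two_pos.le, ENNReal.ofReal_ofNat]
          ring
  refine (lintegral_enorm_modeCorr_sq_le f n a b).trans ?_
  have hre := key (fun z => (G z).re) (Complex.measurable_re.comp hGc.measurable)
    (fun z => (Complex.abs_re_le_norm _).trans (hG1 z).le) (by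
      have := integral_re hGi
      rw [hG0] at this
      simpa using this)
  have him := key (fun z => (G z).im) (Complex.measurable_im.comp hGc.measurable)
    (fun z => (Complex.abs_im_le_norm _).trans (hG1 z).le) (by
      have := integral_im hGi
      rw [hG0] at this
      simpa using this)
  refine (add_le_add hre him).trans_eq ?_
  ring

/-! ### Summing the correlations -/

/-- The nonzero frequencies all of whose components are at most `N` in absolute value. -/
noncomputable def freqBox (d N : ℕ) : Finset (Fin d → ℤ) :=
  (Fintype.piFinset fun _ => Finset.Icc (-(N : ℤ)) N).erase 0

theorem mem_freqBox {N : ℕ} {a : Fin d → ℤ} : a ∈ freqBox d N ↔ a ≠ 0 ∧ ∀ i, |a i| ≤ N := by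
  simp [freqBox, abs_le]

theorem card_freqBox_le (N : ℕ) (hN : 1 ≤ N) : (freqBox d N).card ≤ (3 * N) ^ d := by
  refine (Finset.card_erase_le).trans ?_
  rw [Fintype.card_piFinset]
  simp only [Int.card_Icc, Finset.prod_const, Finset.card_univ, Fintype.card_fin]
  exact Nat.pow_le_pow_left (by omega) d

/-- A weighted sum of all squared correlations of Fourier modes. It dominates all of them, with an
exponential gain `e^{-r n}` in time and a polynomial loss in frequency. The box of size `N + 1`
has the weight `(N + 1)^{-(2d + 2)}`, against about `(N + 1)^{2d}` pairs of frequencies. -/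
noncomputable def corrSum (f : C2Family d) (r : ℝ) (ω : ℕ → E d) : ℝ≥0∞ :=
  1 + ∑' n : ℕ, ENNReal.ofReal (exp (r * n)) *
    ∑' N : ℕ, (((N + 1 : ℕ) : ℝ≥0∞) ^ (2 * d + 2))⁻¹ *
      ∑ a ∈ freqBox d (N + 1), ∑ b ∈ freqBox d (N + 1), ‖modeCorr f n a b ω‖ₑ ^ 2

theorem one_le_corrSum (f : C2Family d) (r : ℝ) (ω : ℕ → E d) : 1 ≤ corrSum f r ω :=
  le_self_add

theorem measurable_corrSum (f : C2Family d) (r : ℝ) : Measurable (corrSum f r) := by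
  have := fun n a b => (measurable_modeCorr f n a b)
  unfold corrSum
  fun_prop

theorem sum_modeCorr_sq_le (f : C2Family d) (r : ℝ) (ω : ℕ → E d) (n : ℕ) {N : ℕ} (hN : 1 ≤ N) :
    ∑ a ∈ freqBox d N, ∑ b ∈ freqBox d N, ‖modeCorr f n a b ω‖ₑ ^ 2 ≤
      (N : ℝ≥0∞) ^ (2 * d + 2) * (ENNReal.ofReal (exp (-(r * n))) * corrSum f r ω) := by
  obtain ⟨N, rfl⟩ := Nat.exists_eq_add_of_le' hN
  set Q := ∑ a ∈ freqBox d (N + 1), ∑ b ∈ freqBox d (N + 1), ‖modeCorr f n a b ω‖ₑ ^ 2 with hQ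
  have h1 : ENNReal.ofReal (exp (r * n)) * ((((N + 1 : ℕ) : ℝ≥0∞) ^ (2 * d + 2))⁻¹ * Q) ≤
      corrSum f r ω := by
    unfold corrSum
    refine le_add_left (le_trans ?_ (ENNReal.le_tsum n))
    gcongr
    exact ENNReal.le_tsum (f := fun N : ℕ => (((N + 1 : ℕ) : ℝ≥0∞) ^ (2 * d + 2))⁻¹ *
      ∑ a ∈ freqBox d (N + 1), ∑ b ∈ freqBox d (N + 1), ‖modeCorr f n a b ω‖ₑ ^ 2) N
  set M : ℝ≥0∞ := ((N + 1 : ℕ) : ℝ≥0∞) ^ (2 * d + 2) with hM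
  have hM0 : M ≠ 0 := pow_ne_zero _ (by simp)
  have hMt : M ≠ ∞ := ENNReal.pow_ne_top (ENNReal.natCast_ne_top _)
  have he : ENNReal.ofReal (exp (-(r * n))) * ENNReal.ofReal (exp (r * n)) = 1 := by
    rw [← ENNReal.ofReal_mul (Real.exp_pos _).le, ← Real.exp_add]
    simp
  calc Q = (M * M⁻¹) * (ENNReal.ofReal (exp (-(r * n))) * ENNReal.ofReal (exp (r * n))) * Q := by
        rw [he, ENNReal.mul_inv_cancel hM0 hMt, one_mul, one_mul]
    _ = M * (ENNReal.ofReal (exp (-(r * n))) * (ENNReal.ofReal (exp (r * n)) * (M⁻¹ * Q))) := by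
        ring
    _ ≤ _ := by gcongr

theorem tsum_ofReal_exp_neg_le {r : ℝ} (hr : r ∈ Ioc (0 : ℝ) 1) :
    ∑' n : ℕ, ENNReal.ofReal (exp (-(r * n))) ≤ ENNReal.ofReal (2 / r) := by
  have h1 : ∀ n : ℕ, ENNReal.ofReal (exp (-(r * n))) = ENNReal.ofReal (exp (-r)) ^ n := by
    intro n
    rw [← ENNReal.ofReal_pow (Real.exp_pos _).le, ← Real.exp_nat_mul]
    congr 2
    ring
  simp only [h1]
  rw [ENNReal.tsum_geometric, ← ENNReal.ofReal_one, ← ENNReal.ofReal_sub _ (Real.exp_pos _).le]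
  have h2 : r / 2 ≤ 1 - exp (-r) := by
    have h3 := Real.add_one_le_exp r
    have h4 : exp (-r) * (1 + r) ≤ 1 := by
      calc exp (-r) * (1 + r) ≤ exp (-r) * exp r := by gcongr; linarith
        _ = 1 := by rw [← Real.exp_add]; simp
    have h5 := Real.exp_pos (-r)
    nlinarith [hr.1, hr.2, mul_nonneg h5.le hr.1.le]
  rw [← ENNReal.ofReal_inv_of_pos (by linarith [hr.1])]
  refine ENNReal.ofReal_le_ofReal ?_
  rw [← inv_div r 2]
  exact inv_anti₀ (by linarith [hr.1]) h2

theorem tsum_inv_natCast_sq_ne_top : ∑' N : ℕ, (((N + 1 : ℕ) : ℝ≥0∞) ^ 2)⁻¹ ≠ ∞ := by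
  have h : Summable fun N : ℕ => ((((N + 1 : ℕ) : ℝ≥0) ^ 2)⁻¹ : ℝ≥0) := by
    rw [← NNReal.summable_coe]
    have := (summable_nat_add_iff 1).2 (Real.summable_nat_pow_inv (p := 2).2 one_lt_two)
    simpa using this
  have h2 := ENNReal.tsum_coe_ne_top_iff_summable.2 h
  convert h2 using 3 with N
  rw [ENNReal.coe_inv (by positivity)]
  simp

/-- The first moment of `corrSum` blows up at most like the inverse of the rate. -/
theorem lintegral_corrSum_le (f : C2Family d) {r : ℝ} (hr : r ∈ Ioc (0 : ℝ) 1) {c : ℝ≥0∞}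
    (h : ∀ n a b, b ≠ 0 → ∫⁻ ω, ‖modeCorr f n a b ω‖ₑ ^ 2 ∂(noiseLaw P₀) ≤
      ENNReal.ofReal (exp (-(2 * r) * n)) * c) :
    ∫⁻ ω, corrSum f r ω ∂(noiseLaw P₀) ≤
      1 + ENNReal.ofReal (2 / r) * ((9 ^ d * ∑' N : ℕ, (((N + 1 : ℕ) : ℝ≥0∞) ^ 2)⁻¹) * c) := by
  have hm := fun n a b => (measurable_modeCorr f n a b)
  have hbox : ∀ n N : ℕ, ∫⁻ ω, ∑ a ∈ freqBox d (N + 1), ∑ b ∈ freqBox d (N + 1),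
      ‖modeCorr f n a b ω‖ₑ ^ 2 ∂(noiseLaw P₀) ≤
        (9 ^ d * ((N + 1 : ℕ) : ℝ≥0∞) ^ (2 * d)) * (ENNReal.ofReal (exp (-(2 * r) * n)) * c) := by
    intro n N
    rw [lintegral_finsetSum _ (by fun_prop)]
    calc ∑ a ∈ freqBox d (N + 1), ∫⁻ ω, ∑ b ∈ freqBox d (N + 1), ‖modeCorr f n a b ω‖ₑ ^ 2
          ∂(noiseLaw P₀)
        ≤ ∑ a ∈ freqBox d (N + 1), ∑ b ∈ freqBox d (N + 1),
            ENNReal.ofReal (exp (-(2 * r) * n)) * c := by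
          refine Finset.sum_le_sum fun a _ => ?_
          rw [lintegral_finsetSum _ (by fun_prop)]
          exact Finset.sum_le_sum fun b hb => h n a b (mem_freqBox.1 hb).1
      _ = ((freqBox d (N + 1)).card * (freqBox d (N + 1)).card : ℝ≥0∞) *
            (ENNReal.ofReal (exp (-(2 * r) * n)) * c) := by
          simp only [Finset.sum_const, nsmul_eq_mul]
          ring
      _ ≤ _ := by
          refine mul_le_mul' ?_ le_rfl
          have h1 : ((freqBox d (N + 1)).card : ℝ≥0∞) ≤ (((3 * (N + 1)) ^ d : ℕ) : ℝ≥0∞) := by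
            exact_mod_cast card_freqBox_le (N + 1) (by omega)
          refine (mul_le_mul' h1 h1).trans_eq ?_
          have h2 : (3 * (N + 1)) ^ d * (3 * (N + 1)) ^ d = 9 ^ d * (N + 1) ^ (2 * d) := by
            rw [← mul_pow, pow_mul, ← mul_pow]
            congr 1
            ring
          exact_mod_cast h2
  have hnN : ∀ n N : ℕ, ENNReal.ofReal (exp (r * n)) * ((((N + 1 : ℕ) : ℝ≥0∞) ^ (2 * d + 2))⁻¹ *
      ((9 ^ d * ((N + 1 : ℕ) : ℝ≥0∞) ^ (2 * d)) * (ENNReal.ofReal (exp (-(2 * r) * n)) * c))) =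
      ENNReal.ofReal (exp (-(r * n))) * ((9 ^ d * (((N + 1 : ℕ) : ℝ≥0∞) ^ 2)⁻¹) * c) := by
    intro n N
    have he : ENNReal.ofReal (exp (r * n)) * ENNReal.ofReal (exp (-(2 * r) * n)) =
        ENNReal.ofReal (exp (-(r * n))) := by
      rw [← ENNReal.ofReal_mul (Real.exp_pos _).le, ← Real.exp_add]
      congr 2
      ring
    set M : ℝ≥0∞ := ((N + 1 : ℕ) : ℝ≥0∞) with hM
    have hM0 : M ≠ 0 := by simp [hM]
    have hMt : M ≠ ∞ := ENNReal.natCast_ne_top _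
    have hMM : (M ^ (2 * d + 2))⁻¹ * M ^ (2 * d) = (M ^ 2)⁻¹ := by
      rw [pow_add, ENNReal.mul_inv (Or.inr (ENNReal.pow_ne_top hMt))
        (Or.inl (ENNReal.pow_ne_top hMt)),
        mul_comm, ← mul_assoc, ENNReal.mul_inv_cancel (pow_ne_zero _ hM0) (ENNReal.pow_ne_top hMt),
        one_mul]
    rw [← he, ← hMM]
    ring
  unfold corrSum
  rw [lintegral_add_left measurable_const, lintegral_const, measure_univ, mul_one,
    lintegral_tsum (by fun_prop)]
  gcongr
  calc ∑' n : ℕ, ∫⁻ ω, ENNReal.ofReal (exp (r * n)) *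
        ∑' N : ℕ, (((N + 1 : ℕ) : ℝ≥0∞) ^ (2 * d + 2))⁻¹ *
          ∑ a ∈ freqBox d (N + 1), ∑ b ∈ freqBox d (N + 1), ‖modeCorr f n a b ω‖ₑ ^ 2
            ∂(noiseLaw P₀)
      ≤ ∑' n : ℕ, ∑' N : ℕ, ENNReal.ofReal (exp (-(r * n))) *
          ((9 ^ d * (((N + 1 : ℕ) : ℝ≥0∞) ^ 2)⁻¹) * c) := by
        refine ENNReal.tsum_le_tsum fun n => ?_
        rw [lintegral_const_mul _ (by fun_prop), lintegral_tsum (by fun_prop),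
          ← ENNReal.tsum_mul_left]
        refine ENNReal.tsum_le_tsum fun N => ?_
        rw [lintegral_const_mul _ (by fun_prop), ← hnN]
        gcongr
        exact hbox n N
    _ = (∑' n : ℕ, ENNReal.ofReal (exp (-(r * n)))) *
          ((9 ^ d * ∑' N : ℕ, (((N + 1 : ℕ) : ℝ≥0∞) ^ 2)⁻¹) * c) := by
        simp only [ENNReal.tsum_mul_left, ENNReal.tsum_mul_right]
    _ ≤ _ := by
        gcongr
        exact tsum_ofReal_exp_neg_le hr

/-! ### Parseval's identity -/

/-- The rescaling isomorphism from the torus `(ℝ / ℤ)ᵈ` to the torus `(ℝ / 2πℤ)ᵈ`. -/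
noncomputable def rescale : UnitAddTorus (Fin d) ≃ₜ T d :=
  Homeomorph.piCongrRight fun _ =>
    AddCircle.homeomorphAddCircle 1 (2 * π) one_ne_zero Real.two_pi_pos.ne'

theorem measurePreserving_homeomorphAddCircle :
    MeasurePreserving (AddCircle.homeomorphAddCircle 1 (2 * π) one_ne_zero Real.two_pi_pos.ne')
      AddCircle.haarAddCircle AddCircle.haarAddCircle :=
  AddMonoidHom.measurePreserving
    (f := (AddCircle.equivAddCircle 1 (2 * π) one_ne_zero Real.two_pi_pos.ne').toAddMonoidHom)
    (AddCircle.homeomorphAddCircle 1 (2 * π) one_ne_zero Real.two_pi_pos.ne').continuous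
    (AddCircle.homeomorphAddCircle 1 (2 * π) one_ne_zero Real.two_pi_pos.ne').surjective
    (by simp)

theorem measurePreserving_rescale :
    MeasurePreserving (rescale (d := d))
      (Measure.pi fun _ : Fin d => (AddCircle.haarAddCircle : Measure UnitAddCircle)) (leb d) :=
  measurePreserving_pi _ _ fun _ => measurePreserving_homeomorphAddCircle

theorem fourier_homeomorphAddCircle (n : ℤ) (t : UnitAddCircle) :
    fourier n (AddCircle.homeomorphAddCircle 1 (2 * π) one_ne_zero Real.two_pi_pos.ne' t) =
      fourier n t := by
  induction t using QuotientAddGroup.induction_on with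
  | H t =>
    rw [AddCircle.homeomorphAddCircle_apply_mk, fourier_coe_apply, fourier_coe_apply]
    congr 1
    have : (π : ℂ) ≠ 0 := by exact_mod_cast Real.pi_ne_zero
    push_cast
    field_simp

/-- **Parseval's identity** on the torus `(ℝ / 2πℤ)ᵈ`. -/
theorem hasSum_sq_fourierCoef {φ : T d → ℂ} (hφ : MemLp φ 2 (leb d)) :
    HasSum (fun a => ‖fourierCoef φ a‖ ^ 2) (∫ x, ‖φ x‖ ^ 2 ∂(leb d)) := by
  have hmp := measurePreserving_rescale (d := d)
  have hemb := (rescale (d := d)).measurableEmbedding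
  have hmem := hφ.comp_measurePreserving hmp
  have h := UnitAddTorus.hasSum_sq_mFourierCoeff (d := Fin d) (hmem.toLp (φ ∘ rescale))
  have h1 : ∫ x, ‖φ x‖ ^ 2 ∂(leb d) = ∫ t, ‖hmem.toLp (φ ∘ rescale) t‖ ^ 2
      ∂(Measure.pi fun _ : Fin d => (AddCircle.haarAddCircle : Measure UnitAddCircle)) := by
    rw [← hmp.integral_comp hemb]
    refine integral_congr_ae ?_
    filter_upwards [hmem.coeFn_toLp] with t ht
    rw [ht]
    rfl
  have h2 : ∀ a, fourierCoef φ a =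
      UnitAddTorus.mFourierCoeff (hmem.toLp (φ ∘ rescale) : UnitAddTorus (Fin d) → ℂ) a := by
    intro a
    refine (hmp.integral_comp hemb
      (fun x : T d => φ x * ∏ i, fourier (-(a i)) (x i))).symm.trans (integral_congr_ae ?_)
    filter_upwards [hmem.coeFn_toLp] with t ht
    rw [ht, smul_eq_mul, mul_comm]
    congr 1
    exact Finset.prod_congr rfl fun i _ => fourier_homeomorphAddCircle _ _
  simp only [h2, h1]
  exact h

/-! ### Truncation of Fourier series -/

theorem mode_mul_prod_fourier_neg (a b : Fin d → ℤ) (x : T d) :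
    mode a x * ∏ i, fourier (-(b i)) (x i) = mode (a - b) x := by
  unfold mode
  rw [← Finset.prod_mul_distrib]
  refine Finset.prod_congr rfl fun i _ => ?_
  rw [← fourier_add, Pi.sub_apply, sub_eq_add_neg]

theorem fourierCoef_mode (a b : Fin d → ℤ) :
    fourierCoef (mode a) b = if a = b then 1 else 0 := by
  unfold fourierCoef
  simp only [mode_mul_prod_fourier_neg]
  split_ifs with h
  · subst h
    simp [mode]
  · exact integral_mode (sub_ne_zero.2 h)

theorem integrable_mul_prod_fourier {φ : T d → ℂ} (hφ : Integrable φ (leb d)) (a : Fin d → ℤ) :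
    Integrable (fun x => φ x * ∏ i, fourier (-(a i)) (x i)) (leb d) := by
  have hc : Continuous fun x : T d => ∏ i, fourier (-(a i)) (x i) := by fun_prop
  refine hφ.mul_bdd (c := 1) hc.aestronglyMeasurable (Eventually.of_forall fun x => ?_)
  have := norm_mode (-a) x
  exact this.le

theorem fourierCoef_sub {φ ψ : T d → ℂ} (hφ : Integrable φ (leb d)) (hψ : Integrable ψ (leb d))
    (a : Fin d → ℤ) : fourierCoef (φ - ψ) a = fourierCoef φ a - fourierCoef ψ a := by
  unfold fourierCoef
  rw [← integral_sub (integrable_mul_prod_fourier hφ a) (integrable_mul_prod_fourier hψ a)]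
  simp only [Pi.sub_apply, sub_mul]

theorem fourierCoef_zero (φ : T d → ℂ) : fourierCoef φ 0 = ∫ x, φ x ∂(leb d) := by
  simp [fourierCoef]

/-- The truncation of the Fourier series of `φ` to the frequencies in `freqBox d N`. -/
noncomputable def truncate (N : ℕ) (φ : T d → ℂ) (x : T d) : ℂ :=
  ∑ a ∈ freqBox d N, fourierCoef φ a * mode a x

theorem continuous_truncate (N : ℕ) (φ : T d → ℂ) : Continuous (truncate N φ) :=
  continuous_finsetSum _ fun a _ => continuous_const.mul (continuous_mode a)

theorem memLp_truncate (N : ℕ) (φ : T d → ℂ) (q : ℝ≥0∞) : MemLp (truncate N φ) q (leb d) :=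
  (continuous_truncate N φ).memLp_of_hasCompactSupport (HasCompactSupport.of_compactSpace _)

theorem integrable_mode (a : Fin d → ℤ) : Integrable (mode a) (leb d) :=
  Integrable.of_bound (continuous_mode a).aestronglyMeasurable 1
    (Eventually.of_forall fun x => (norm_mode a x).le)

theorem fourierCoef_truncate (N : ℕ) (φ : T d → ℂ) (b : Fin d → ℤ) :
    fourierCoef (truncate N φ) b = if b ∈ freqBox d N then fourierCoef φ b else 0 := by
  have h : fourierCoef (truncate N φ) b =
      ∑ a ∈ freqBox d N, fourierCoef φ a * fourierCoef (mode a) b := by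
    unfold truncate
    rw [fourierCoef]
    simp only [Finset.sum_mul, mul_assoc]
    rw [integral_finsetSum]
    · simp only [integral_const_mul]
      rfl
    · exact fun a _ => (integrable_mul_prod_fourier (integrable_mode a) b).const_mul _
  rw [h]
  simp [fourierCoef_mode]

section Sobolev

variable {φ ψ : T d → ℂ}

theorem sobolevTerm_nonneg (φ : T d → ℂ) (a : Fin d → ℤ) : 0 ≤ sobolevTerm φ a := by
  unfold sobolevTerm
  positivity

theorem H1norm_nonneg (φ : T d → ℂ) : 0 ≤ H1norm φ := Real.sqrt_nonneg _

theorem sq_H1norm (φ : T d → ℂ) : H1norm φ ^ 2 = ∑' a, sobolevTerm φ a :=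
  Real.sq_sqrt (tsum_nonneg (sobolevTerm_nonneg φ))

theorem MeanZeroH1.fourierCoef_zero_eq (hφ : MeanZeroH1 φ) : fourierCoef φ 0 = 0 := by
  rw [fourierCoef_zero, hφ.mean_zero]

theorem MeanZeroH1.integrable (hφ : MeanZeroH1 φ) : Integrable φ (leb d) :=
  hφ.memLp.integrable one_le_two

/-- If the Fourier coefficients of `χ` are those of `φ` at frequencies at least `R` and vanish
elsewhere, then the `L²` norm of `χ` is at most `R⁻¹` times the Sobolev norm of `φ`. -/
theorem MeanZeroH1.sqrt_integral_sq_le (hφ : MeanZeroH1 φ) {χ : T d → ℂ} (hχ : MemLp χ 2 (leb d))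
    {R : ℝ} (hR : 0 < R) (h : ∀ a, fourierCoef χ a = 0 ∨
      (‖fourierCoef χ a‖ = ‖fourierCoef φ a‖ ∧ R ^ 2 ≤ ∑ i, (a i : ℝ) ^ 2)) :
    √(∫ x, ‖χ x‖ ^ 2 ∂(leb d)) ≤ H1norm φ / R := by
  refine Real.sqrt_le_iff.2 ⟨div_nonneg (H1norm_nonneg φ) hR.le, ?_⟩
  have h1 := hasSum_sq_fourierCoef hχ
  rw [div_pow, sq_H1norm, ← h1.tsum_eq, le_div_iff₀ (by positivity), ← tsum_mul_right]
  refine Summable.tsum_le_tsum (fun a => ?_) (h1.summable.mul_right _) hφ.summable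
  rcases h a with h0 | ⟨h0, h2⟩
  · rw [h0]
    simpa using sobolevTerm_nonneg φ a
  · rw [h0, sobolevTerm, mul_comm]
    gcongr

theorem one_le_sum_sq {a : Fin d → ℤ} (ha : a ≠ 0) : (1 : ℝ) ≤ ∑ i, (a i : ℝ) ^ 2 := by
  obtain ⟨i, hi⟩ := Function.ne_iff.1 ha
  have h1 : (1 : ℤ) ≤ (a i) ^ 2 := Int.one_le_abs hi |> fun h => by
    rw [← sq_abs]
    exact one_le_pow₀ h
  have h2 : (1 : ℝ) ≤ (a i : ℝ) ^ 2 := by exact_mod_cast h1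
  exact h2.trans (Finset.single_le_sum (f := fun i => (a i : ℝ) ^ 2) (fun _ _ => sq_nonneg _)
    (Finset.mem_univ i))

theorem sq_le_sum_sq {a : Fin d → ℤ} (ha : a ≠ 0) {N : ℕ} (h : a ∉ freqBox d N) :
    (N : ℝ) ^ 2 ≤ ∑ i, (a i : ℝ) ^ 2 := by
  have : ∃ i, (N : ℤ) < |a i| := by
    by_contra! hcon
    exact h (mem_freqBox.2 ⟨ha, hcon⟩)
  obtain ⟨i, hi⟩ := this
  have h2 : (N : ℝ) ≤ |(a i : ℝ)| := by exact_mod_cast hi.le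
  have h3 : (N : ℝ) ^ 2 ≤ (a i : ℝ) ^ 2 := by
    rw [← sq_abs (a i : ℝ)]
    gcongr
  exact h3.trans (Finset.single_le_sum (f := fun i => (a i : ℝ) ^ 2) (fun _ _ => sq_nonneg _)
    (Finset.mem_univ i))

/-- The Poincaré inequality. -/
theorem MeanZeroH1.sqrt_integral_sq_le_H1norm (hφ : MeanZeroH1 φ) :
    √(∫ x, ‖φ x‖ ^ 2 ∂(leb d)) ≤ H1norm φ := by
  have := hφ.sqrt_integral_sq_le hφ.memLp one_pos fun a => by
    rcases eq_or_ne a 0 with rfl | ha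
    · exact Or.inl hφ.fourierCoef_zero_eq
    · exact Or.inr ⟨rfl, by simpa using one_le_sum_sq ha⟩
  rwa [div_one] at this

theorem MeanZeroH1.sqrt_integral_sq_truncate_le (hφ : MeanZeroH1 φ) (N : ℕ) :
    √(∫ x, ‖truncate N φ x‖ ^ 2 ∂(leb d)) ≤ H1norm φ := by
  have := hφ.sqrt_integral_sq_le (memLp_truncate N φ 2) one_pos fun a => by
    rw [fourierCoef_truncate]
    split_ifs with h
    · exact Or.inr ⟨rfl, by simpa using one_le_sum_sq (mem_freqBox.1 h).1⟩
    · exact Or.inl rfl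
  rwa [div_one] at this

theorem MeanZeroH1.sqrt_integral_sq_sub_truncate_le (hφ : MeanZeroH1 φ) {N : ℕ} (hN : 1 ≤ N) :
    √(∫ x, ‖(φ - truncate N φ) x‖ ^ 2 ∂(leb d)) ≤ H1norm φ / N := by
  refine hφ.sqrt_integral_sq_le (hφ.memLp.sub (memLp_truncate N φ 2)) (by exact_mod_cast hN)
    fun a => ?_
  rw [fourierCoef_sub hφ.integrable ((memLp_truncate N φ 2).integrable one_le_two),
    fourierCoef_truncate]
  split_ifs with h
  · exact Or.inl (sub_self _)
  · rw [sub_zero]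
    rcases eq_or_ne a 0 with rfl | ha
    · exact Or.inl hφ.fourierCoef_zero_eq
    · exact Or.inr ⟨rfl, sq_le_sum_sq ha h⟩

theorem MeanZeroH1.sum_sq_fourierCoef_le (hφ : MeanZeroH1 φ) (s : Finset (Fin d → ℤ)) :
    ∑ a ∈ s, ‖fourierCoef φ a‖ ^ 2 ≤ H1norm φ ^ 2 := by
  have h1 := sum_le_hasSum s (fun _ _ => by positivity) (hasSum_sq_fourierCoef hφ.memLp)
  exact h1.trans ((Real.sqrt_le_left (H1norm_nonneg φ)).1 hφ.sqrt_integral_sq_le_H1norm)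

/-- The Cauchy-Schwarz inequality in `L²`. -/
theorem norm_integral_mul_le_sqrt (hφ : MemLp φ 2 (leb d)) (hψ : MemLp ψ 2 (leb d)) :
    ‖∫ x, φ x * ψ x ∂(leb d)‖ ≤
      √(∫ x, ‖φ x‖ ^ 2 ∂(leb d)) * √(∫ x, ‖ψ x‖ ^ 2 ∂(leb d)) := by
  refine (norm_integral_le_integral_norm _).trans ?_
  have h := integral_mul_norm_le_Lp_mul_Lq (μ := leb d) (f := φ) (g := ψ) (p := 2) (q := 2)
    ⟨by norm_num, by norm_num, by norm_num⟩ (by simpa using hφ) (by simpa using hψ)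
  simp only [norm_mul]
  rw [Real.sqrt_eq_rpow, Real.sqrt_eq_rpow]
  simpa using h

theorem sqrt_integral_sq_comp {F : T d → T d} (hF : MeasurePreserving F (leb d) (leb d))
    (hψ : MemLp ψ 2 (leb d)) :
    √(∫ x, ‖ψ (F x)‖ ^ 2 ∂(leb d)) = √(∫ x, ‖ψ x‖ ^ 2 ∂(leb d)) := by
  congr 1
  conv_rhs => rw [← hF.map_eq]
  rw [integral_map hF.measurable.aemeasurable]
  rw [hF.map_eq]
  exact (hψ.aestronglyMeasurable.norm.pow 2)

end Sobolev

/-! ### From Fourier modes to Sobolev functions -/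

section Correlation

variable {F : T d → T d} {φ ψ : T d → ℂ}

/-- The trivial bound on correlations. -/
theorem MeanZeroH1.norm_integral_mul_comp_le (hφ : MeanZeroH1 φ) (hψ : MeanZeroH1 ψ)
    (hF : MeasurePreserving F (leb d) (leb d)) :
    ‖∫ x, φ x * ψ (F x) ∂(leb d)‖ ≤ H1norm φ * H1norm ψ := by
  refine (norm_integral_mul_le_sqrt hφ.memLp (hψ.memLp.comp_measurePreserving hF)).trans ?_
  have h := sqrt_integral_sq_comp hF hψ.memLp
  simp only [Function.comp_apply]
  rw [h]
  exact mul_le_mul hφ.sqrt_integral_sq_le_H1norm hψ.sqrt_integral_sq_le_H1norm (Real.sqrt_nonneg _)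
    (H1norm_nonneg φ)

/-- For trigonometric polynomials the correlation is controlled by the Hilbert-Schmidt norm of the
matrix of correlations of modes. -/
theorem MeanZeroH1.norm_integral_truncate_le (hφ : MeanZeroH1 φ) (hψ : MeanZeroH1 ψ)
    (hF : Measurable F) (N : ℕ) :
    ‖∫ x, truncate N φ x * truncate N ψ (F x) ∂(leb d)‖ ≤
      H1norm φ * H1norm ψ * √(∑ a ∈ freqBox d N, ∑ b ∈ freqBox d N,
        ‖∫ x, mode a x * mode b (F x) ∂(leb d)‖ ^ 2) := by
  set c : (Fin d → ℤ) → (Fin d → ℤ) → ℂ := fun a b => ∫ x, mode a x * mode b (F x) ∂(leb d) with hc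
  have hint : ∀ a b : Fin d → ℤ, Integrable (fun x => mode a x * mode b (F x)) (leb d) := fun a b =>
    Integrable.of_bound ((continuous_mode a).measurable.mul
      ((continuous_mode b).measurable.comp hF)).aestronglyMeasurable 1
      (Eventually.of_forall fun x => by rw [norm_mul, norm_mode, norm_mode, mul_one])
  have h1 : ∫ x, truncate N φ x * truncate N ψ (F x) ∂(leb d) =
      ∑ a ∈ freqBox d N, ∑ b ∈ freqBox d N, fourierCoef φ a * fourierCoef ψ b * c a b := by
    have h2 : ∀ x, truncate N φ x * truncate N ψ (F x) = ∑ a ∈ freqBox d N, ∑ b ∈ freqBox d N,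
        fourierCoef φ a * fourierCoef ψ b * (mode a x * mode b (F x)) := by
      intro x
      rw [truncate, truncate, Finset.sum_mul_sum]
      exact Finset.sum_congr rfl fun a _ => Finset.sum_congr rfl fun b _ => by ring
    simp only [h2]
    rw [integral_finsetSum _ fun a _ => integrable_finsetSum _ fun b _ => (hint a b).const_mul _]
    refine Finset.sum_congr rfl fun a _ => ?_
    rw [integral_finsetSum _ fun b _ => (hint a b).const_mul _]
    exact Finset.sum_congr rfl fun b _ => integral_const_mul _ _
  rw [h1, ← Finset.sum_product', ← Finset.sum_product']
  set s := freqBox d N ×ˢ freqBox d N with hs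
  have h3 : ∑ z ∈ s, (‖fourierCoef φ z.1‖ * ‖fourierCoef ψ z.2‖) ^ 2 ≤
      (H1norm φ * H1norm ψ) ^ 2 := by
    rw [hs, Finset.sum_product]
    simp only [mul_pow]
    rw [← Finset.sum_mul_sum]
    exact mul_le_mul (hφ.sum_sq_fourierCoef_le _) (hψ.sum_sq_fourierCoef_le _)
      (Finset.sum_nonneg fun _ _ => by positivity) (by positivity)
  have hH : 0 ≤ H1norm φ * H1norm ψ := mul_nonneg (H1norm_nonneg φ) (H1norm_nonneg ψ)
  calc ‖∑ z ∈ s, fourierCoef φ z.1 * fourierCoef ψ z.2 * c z.1 z.2‖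
      ≤ ∑ z ∈ s, ‖fourierCoef φ z.1‖ * ‖fourierCoef ψ z.2‖ * ‖c z.1 z.2‖ := by
        refine (norm_sum_le _ _).trans (Finset.sum_le_sum fun z _ => ?_)
        rw [norm_mul, norm_mul]
    _ ≤ √(∑ z ∈ s, (‖fourierCoef φ z.1‖ * ‖fourierCoef ψ z.2‖) ^ 2) *
        √(∑ z ∈ s, ‖c z.1 z.2‖ ^ 2) := Real.sum_mul_le_sqrt_mul_sqrt _ _ _
    _ ≤ H1norm φ * H1norm ψ * √(∑ z ∈ s, ‖c z.1 z.2‖ ^ 2) := by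
        gcongr
        exact Real.sqrt_le_iff.2 ⟨hH, h3⟩

/-- Splitting both functions into low and high frequencies. -/
theorem MeanZeroH1.norm_integral_mul_comp_le_of_sum_le (hφ : MeanZeroH1 φ) (hψ : MeanZeroH1 ψ)
    (hF : MeasurePreserving F (leb d) (leb d)) {N : ℕ} (hN : 1 ≤ N) {M : ℝ}
    (hM : ∑ a ∈ freqBox d N, ∑ b ∈ freqBox d N, ‖∫ x, mode a x * mode b (F x) ∂(leb d)‖ ^ 2 ≤ M) :
    ‖∫ x, φ x * ψ (F x) ∂(leb d)‖ ≤ (2 / N + √M) * (H1norm φ * H1norm ψ) := by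
  have hφN := memLp_truncate N φ 2
  have hψN := memLp_truncate N ψ 2
  have hφr := hφ.memLp.sub hφN
  have hψr := hψ.memLp.sub hψN
  have hψF := hψ.memLp.comp_measurePreserving hF
  have hψNF := hψN.comp_measurePreserving hF
  have hψrF := hψr.comp_measurePreserving hF
  have i1 : Integrable (fun x => (φ - truncate N φ) x * (ψ ∘ F) x) (leb d) :=
    hφr.integrable_mul hψF
  have i2 : Integrable (fun x => truncate N φ x * ((ψ - truncate N ψ) ∘ F) x) (leb d) :=
    hφN.integrable_mul hψrF
  have i3 : Integrable (fun x => truncate N φ x * (truncate N ψ ∘ F) x) (leb d) :=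
    hφN.integrable_mul hψNF
  have hsplit : ∫ x, φ x * ψ (F x) ∂(leb d) =
      ∫ x, (φ - truncate N φ) x * (ψ ∘ F) x ∂(leb d) +
        (∫ x, truncate N φ x * ((ψ - truncate N ψ) ∘ F) x ∂(leb d) +
          ∫ x, truncate N φ x * (truncate N ψ ∘ F) x ∂(leb d)) := by
    have i23 : Integrable (fun x => truncate N φ x * ((ψ - truncate N ψ) ∘ F) x +
        truncate N φ x * (truncate N ψ ∘ F) x) (leb d) := i2.add i3
    rw [← integral_add i2 i3, ← integral_add i1 i23]
    refine integral_congr_ae (Eventually.of_forall fun x => ?_)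
    simp only [Pi.sub_apply, Function.comp_apply]
    ring
  have hHφ := H1norm_nonneg φ
  have hHψ := H1norm_nonneg ψ
  have hN0 : (0 : ℝ) < N := by exact_mod_cast hN
  have b1 : ‖∫ x, (φ - truncate N φ) x * (ψ ∘ F) x ∂(leb d)‖ ≤ H1norm φ / N * H1norm ψ := by
    refine (norm_integral_mul_le_sqrt hφr hψF).trans ?_
    have h := sqrt_integral_sq_comp hF hψ.memLp
    simp only [Function.comp_apply]
    rw [h]
    exact mul_le_mul (hφ.sqrt_integral_sq_sub_truncate_le hN) hψ.sqrt_integral_sq_le_H1norm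
      (Real.sqrt_nonneg _) (by positivity)
  have b2 : ‖∫ x, truncate N φ x * ((ψ - truncate N ψ) ∘ F) x ∂(leb d)‖ ≤
      H1norm φ * (H1norm ψ / N) := by
    refine (norm_integral_mul_le_sqrt hφN hψrF).trans ?_
    have h := sqrt_integral_sq_comp hF hψr
    simp only [Function.comp_apply]
    rw [h]
    exact mul_le_mul (hφ.sqrt_integral_sq_truncate_le N) (hψ.sqrt_integral_sq_sub_truncate_le hN)
      (Real.sqrt_nonneg _) hHφ
  have b3 : ‖∫ x, truncate N φ x * (truncate N ψ ∘ F) x ∂(leb d)‖ ≤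
      H1norm φ * H1norm ψ * √M := by
    refine (hφ.norm_integral_truncate_le hψ hF.measurable N).trans ?_
    gcongr
  rw [hsplit]
  refine (norm_add_le _ _).trans ((add_le_add b1 ((norm_add_le _ _).trans
    (add_le_add b2 b3))).trans_eq ?_)
  field_simp
  ring

/-- Interpolation: if the correlations of all Fourier modes are small in mean square, with a
polynomial loss in the frequency, then so are those of all Sobolev functions, uniformly. -/
theorem MeanZeroH1.norm_integral_mul_comp_le_rpow (hφ : MeanZeroH1 φ) (hψ : MeanZeroH1 ψ)
    (hF : MeasurePreserving F (leb d) (leb d)) {X : ℝ} (hX : 0 < X)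
    (h : ∀ N : ℕ, 1 ≤ N → ∑ a ∈ freqBox d N, ∑ b ∈ freqBox d N,
      ‖∫ x, mode a x * mode b (F x) ∂(leb d)‖ ^ 2 ≤ (N : ℝ) ^ (2 * d + 2) * X) :
    ‖∫ x, φ x * ψ (F x) ∂(leb d)‖ ≤
      (2 + 2 ^ (d + 1)) * X ^ (1 / (2 * ((d : ℝ) + 2))) * (H1norm φ * H1norm ψ) := by
  have hH : 0 ≤ H1norm φ * H1norm ψ := mul_nonneg (H1norm_nonneg φ) (H1norm_nonneg ψ)
  set κ : ℝ := 1 / (2 * ((d : ℝ) + 2)) with hκ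
  have hκ0 : 0 < κ := by positivity
  set y := X ^ κ with hy
  have hy0 : 0 < y := Real.rpow_pos_of_pos hX κ
  rcases le_or_gt 1 X with hX1 | hX1
  · refine (hφ.norm_integral_mul_comp_le hψ hF).trans (le_mul_of_one_le_left hH ?_)
    have h1 : 1 ≤ y := Real.one_le_rpow hX1 hκ0.le
    have h2 : (0 : ℝ) < 2 ^ (d + 1) := by positivity
    nlinarith
  · have hy1 : y ≤ 1 := Real.rpow_le_one hX.le hX1.le hκ0.le
    -- the truncation balancing the two errors
    set N := ⌈1 / y⌉₊ with hN
    have hN1 : 1 ≤ N := Nat.one_le_ceil_iff.2 (by positivity)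
    have hN0 : (0 : ℝ) < N := by exact_mod_cast hN1
    have hlow : 1 / y ≤ N := Nat.le_ceil _
    have hupp : (N : ℝ) ≤ 2 / y := by
      have h1 := Nat.ceil_lt_add_one (a := 1 / y) (by positivity)
      have h2 : 1 ≤ 1 / y := by rwa [le_div_iff₀ hy0, one_mul]
      have h3 : 2 / y = 1 / y + 1 / y := by ring
      rw [h3]
      exact h1.le.trans (by linarith)
    refine (hφ.norm_integral_mul_comp_le_of_sum_le hψ hF hN1 (h N hN1)).trans ?_
    refine mul_le_mul_of_nonneg_right ?_ hH
    have e1 : 2 / (N : ℝ) ≤ 2 * y := by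
      rw [div_le_iff₀ hN0]
      rw [div_le_iff₀ hy0] at hlow
      linarith
    have hXy : X = (y ^ (d + 2)) ^ 2 := by
      rw [← pow_mul, hy, ← Real.rpow_natCast, ← Real.rpow_mul hX.le]
      have : κ * (((d + 2) * 2 : ℕ) : ℝ) = 1 := by
        rw [hκ]
        push_cast
        field_simp
      rw [this, Real.rpow_one]
    have e2 : √((N : ℝ) ^ (2 * d + 2) * X) ≤ 2 ^ (d + 1) * y := by
      have h1 : (N : ℝ) ^ (2 * d + 2) * X = ((N : ℝ) ^ (d + 1) * y ^ (d + 2)) ^ 2 := by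
        conv_lhs => rw [hXy]
        ring
      rw [h1, Real.sqrt_sq (by positivity)]
      calc (N : ℝ) ^ (d + 1) * y ^ (d + 2) ≤ (2 / y) ^ (d + 1) * y ^ (d + 2) := by gcongr
        _ = 2 ^ (d + 1) * y := by
          rw [div_pow, pow_succ y (d + 1)]
          field_simp
    linarith

end Correlation

/-! ### The random constant -/

/-- An integrable random variable controlling all correlations of a single system. The rate and
the size of its first moment are governed by `α / L`, with constants depending only on the
dimension and on the exponent of the Lyapunov function. -/
theorem exists_random_constant (hd : 0 < d) {p : ℝ} (hp : p ∈ Ioo (0 : ℝ) 1) :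
    ∃ Γ : ℝ, 1 ≤ Γ ∧ ∀ (P₀ : Measure (E d)) [IsProbabilityMeasure P₀] (f : C2Family d)
      (_ : StandingHypothesis P₀ f) (L : ℕ) (_ : 0 < L) (K α : ℝ) (_ : 1 ≤ K)
      (_ : α ∈ Ioo (0 : ℝ) 1)
      (_ : ∀ z, lTransition P₀ f L (lyapunov p) z ≤ 2⁻¹ * lyapunov p z + 2 * ENNReal.ofReal K)
      (ν : Measure (T d × T d)) [IsProbabilityMeasure ν]
      (_ : ∀ z, lyapunov p z ≤ ENNReal.ofReal (32 * K) →
        ENNReal.ofReal α • ν ≤ twoPoint P₀ f L z.1 z.2),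
      ∃ S : (ℕ → E d) → ℝ≥0∞, Measurable S ∧ (∀ ω, 1 ≤ S ω) ∧
        ∫⁻ ω, S ω ∂(noiseLaw P₀) ≤ ENNReal.ofReal (Γ * (L / α)) ∧
        ∀ᵐ ω ∂(noiseLaw P₀), S ω ≠ ∞ ∧ ∀ φ ψ : T d → ℂ, MeanZeroH1 φ → MeanZeroH1 ψ → ∀ n : ℕ,
          ‖∫ x, φ x * ψ (f.iter n ω x) ∂(leb d)‖ ≤
            ((S ω).toReal * exp (-(α / (16 * L) * n))) ^ (1 / (2 * ((d : ℝ) + 2))) *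
              (H1norm φ * H1norm ψ) := by
  set Z : ℝ≥0∞ := (9 ^ d * ∑' N : ℕ, (((N + 1 : ℕ) : ℝ≥0∞) ^ 2)⁻¹) *
    (8 * (1 + ∫⁻ z, lyapunov (d := d) p z ∂((leb d).prod (leb d)))) with hZ
  have hZt : Z ≠ ∞ := by
    refine ENNReal.mul_ne_top (ENNReal.mul_ne_top (by finiteness) tsum_inv_natCast_sq_ne_top)
      (ENNReal.mul_ne_top (by finiteness) (ENNReal.add_ne_top.2 ⟨by finiteness, ?_⟩))
    exact (lintegral_lyapunov_lt_top hd hp).ne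
  have hZr : Z = ENNReal.ofReal Z.toReal := (ENNReal.ofReal_toReal hZt).symm
  set z := Z.toReal with hz
  have hz0 : 0 ≤ z := ENNReal.toReal_nonneg
  -- absorbs the constant of the interpolation inequality into the random variable
  set B : ℝ := (2 + 2 ^ (d + 1)) ^ (2 * (d + 2)) with hB
  have hB1 : 1 ≤ B := one_le_pow₀ (by linarith [pow_pos (two_pos (α := ℝ)) (d + 1)])
  refine ⟨B * (1 + 32 * z), one_le_mul_of_one_le_of_one_le hB1 (by linarith), ?_⟩
  intro P₀ _ f hf L hL K α hK hα hdrift ν _ hmin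
  have hL1 : (1 : ℝ) ≤ L := by exact_mod_cast hL
  have hα0 := hα.1
  set r := α / (16 * L) with hr
  have hr0 : 0 < r := by positivity
  have hr1 : r ≤ 1 := by
    rw [hr, div_le_one (by positivity)]
    linarith [hα.2]
  have h2r : 2 * r = α / (8 * L) := by rw [hr]; field_simp; norm_num
  have hmom := lintegral_corrSum_le (P₀ := P₀) f ⟨hr0, hr1⟩
    (c := 8 * (1 + ∫⁻ z, lyapunov (d := d) p z ∂((leb d).prod (leb d)))) fun n a b hb => by
      rw [h2r]
      exact lintegral_enorm_modeCorr_sq_le_exp hf hL (measurable_lyapunov p) hK hα hdrift hmin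
        n a hb
  have hmeas := measurable_corrSum f r
  have hmomS : ∫⁻ ω, ENNReal.ofReal B * corrSum f r ω ∂(noiseLaw P₀) ≤
      ENNReal.ofReal (B * (1 + 32 * z) * (L / α)) := by
    rw [lintegral_const_mul _ hmeas, mul_assoc, ENNReal.ofReal_mul (by positivity)]
    gcongr
    refine hmom.trans ?_
    rw [← hZ, hZr, ← ENNReal.ofReal_mul (by positivity), ← ENNReal.ofReal_one,
      ← ENNReal.ofReal_add zero_le_one (by positivity)]
    refine ENNReal.ofReal_le_ofReal ?_
    have h1 : 1 ≤ L / α := by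
      rw [le_div_iff₀ hα0]
      linarith [hα.2]
    have h2 : 2 / r = 32 * (L / α) := by
      rw [hr]
      field_simp
      norm_num
    rw [h2]
    nlinarith
  refine ⟨fun ω => ENNReal.ofReal B * corrSum f r ω, hmeas.const_mul _, fun ω => ?_, hmomS, ?_⟩
  · exact one_le_mul (ENNReal.one_le_ofReal.2 hB1) (one_le_corrSum f r ω)
  filter_upwards [ae_lt_top (hmeas.const_mul _) (hmomS.trans_lt ENNReal.ofReal_lt_top).ne,
    ae_measurePreserving_iter hf] with ω hω hpres
  refine ⟨hω.ne, fun φ ψ hφ hψ n => ?_⟩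
  have hSt : corrSum f r ω ≠ ∞ := by
    intro htop
    rw [htop, ENNReal.mul_top (by simpa using one_pos.trans_le hB1)] at hω
    exact lt_irrefl _ hω
  obtain ⟨s, hs1, hs⟩ : ∃ s : ℝ, 1 ≤ s ∧ corrSum f r ω = ENNReal.ofReal s := by
    refine ⟨(corrSum f r ω).toReal, ?_, (ENNReal.ofReal_toReal hSt).symm⟩
    rw [← ENNReal.toReal_one]
    exact (ENNReal.toReal_le_toReal ENNReal.one_ne_top hSt).2 (one_le_corrSum f r ω)
  have hs0 : 0 < s := one_pos.trans_le hs1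
  have hX0 : 0 < s * exp (-(r * n)) := mul_pos hs0 (Real.exp_pos _)
  have hmain := hφ.norm_integral_mul_comp_le_rpow hψ (hpres n) hX0 fun N hN => by
    have h1 := sum_modeCorr_sq_le f r ω n hN
    rw [hs, ← ENNReal.ofReal_mul (Real.exp_pos _).le, ← ENNReal.ofReal_natCast,
      ← ENNReal.ofReal_pow (Nat.cast_nonneg _), ← ENNReal.ofReal_mul (by positivity)] at h1
    have h2 : ∑ a ∈ freqBox d N, ∑ b ∈ freqBox d N, ‖modeCorr f n a b ω‖ₑ ^ 2 =
        ENNReal.ofReal (∑ a ∈ freqBox d N, ∑ b ∈ freqBox d N, ‖modeCorr f n a b ω‖ ^ 2) := by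
      rw [ENNReal.ofReal_sum_of_nonneg fun _ _ => Finset.sum_nonneg fun _ _ => by positivity]
      refine Finset.sum_congr rfl fun a _ => ?_
      rw [ENNReal.ofReal_sum_of_nonneg fun _ _ => by positivity]
      refine Finset.sum_congr rfl fun b _ => ?_
      rw [ENNReal.ofReal_pow (norm_nonneg _), ofReal_norm]
    rw [h2, ENNReal.ofReal_le_ofReal_iff (by positivity), mul_comm (exp _)] at h1
    exact h1
  refine hmain.trans_eq ?_
  congr 1
  have hBs : (ENNReal.ofReal B * corrSum f r ω).toReal = B * s := by
    rw [hs, ← ENNReal.ofReal_mul (by positivity), ENNReal.toReal_ofReal (by positivity)]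
  rw [hBs, mul_assoc, Real.mul_rpow (by positivity) hX0.le]
  congr 1
  rw [hB, ← Real.rpow_natCast _ (2 * (d + 2)), ← Real.rpow_mul (by positivity)]
  have : (((2 * (d + 2) : ℕ) : ℝ)) * (1 / (2 * ((d : ℝ) + 2))) = 1 := by
    push_cast
    field_simp
  rw [this, Real.rpow_one]

/-! ### Choice of exponents -/

/-- With the exponent `θ = min(a, b) / (4 max(a, b))`, where `b = L⁻¹`, the power `(a b)^{-θ}` does
not depend on `a` any more: it is at most of order `√L`. -/
theorem rpow_min_div_max_le {a : ℝ} (ha : a ∈ Ioo (0 : ℝ) 1) {L : ℕ} (hL : 0 < L) :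
    ((L : ℝ) / a) ^ (min a (L : ℝ)⁻¹ / (4 * max a (L : ℝ)⁻¹)) ≤ 3 * √L := by
  have hL1 : (1 : ℝ) ≤ L := by exact_mod_cast hL
  have hL0 : (0 : ℝ) < L := one_pos.trans_le hL1
  set b := (L : ℝ)⁻¹ with hb
  have hb0 : 0 < b := inv_pos.2 hL0
  have hb1 : b ≤ 1 := inv_le_one_of_one_le₀ hL1
  have ha0 := ha.1
  set M := max a b with hM
  have hM0 : 0 < M := lt_max_of_lt_left ha0
  have hM1 : M ≤ 1 := max_le ha.2.le hb1
  set t := min a b with ht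
  have ht0 : 0 < t := lt_min ha0 hb0
  set u := t / M with hu
  have hu0 : 0 < u := div_pos ht0 hM0
  have hu1 : u ≤ 1 := (div_le_one hM0).2 (min_le_max)
  have hprod : (L : ℝ) / a = (u * M ^ 2)⁻¹ := by
    have h1 : u * M ^ 2 = a * b := by
      rw [hu, ← min_mul_max a b, ← hM, ← ht]
      field_simp
    rw [h1, hb, mul_inv, inv_inv]
    field_simp
  have hθ : t / (4 * M) = u / 4 := by rw [hu]; field_simp
  rw [hθ, hprod, Real.rpow_def_of_pos (by positivity), Real.log_inv,
    Real.log_mul hu0.ne' (by positivity), Real.log_pow]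
  have e1 : u * (-Real.log u) ≤ 1 := by
    have h1 := Real.log_le_sub_one_of_pos (inv_pos.2 hu0)
    rw [Real.log_inv] at h1
    calc u * (-Real.log u) ≤ u * (u⁻¹ - 1) := by gcongr
      _ ≤ u * u⁻¹ := by gcongr; linarith
      _ = 1 := mul_inv_cancel₀ hu0.ne'
  have e2 : -Real.log M ≤ Real.log L := by
    have h1 : Real.log b ≤ Real.log M := Real.log_le_log hb0 (le_max_right _ _)
    rw [hb, Real.log_inv] at h1
    linarith
  have e3 : 0 ≤ -Real.log M := by linarith [Real.log_nonpos hM0.le hM1]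
  have e4 : u * (-Real.log M) ≤ Real.log L := (mul_le_of_le_one_left e3 hu1).trans e2
  calc exp (-(Real.log u + (2 : ℕ) * Real.log M) * (u / 4))
      ≤ exp (1 + Real.log L / 2) := by
        refine Real.exp_le_exp.2 ?_
        push_cast
        nlinarith
    _ = exp 1 * √L := by
        rw [Real.exp_add, Real.exp_half, Real.exp_log hL0]
    _ ≤ 3 * √L := by
        gcongr
        linarith [Real.exp_one_lt_d9]

/-- Fractional moments of a random variable of given mean. -/
theorem lintegral_rpow_le_two_mul {Ω : Type*} [MeasurableSpace Ω] {μ : Measure Ω}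
    [IsProbabilityMeasure μ] {S : Ω → ℝ≥0∞} {M θ : ℝ} (hM : 0 < M)
    (h : ∫⁻ ω, S ω ∂μ ≤ ENNReal.ofReal M) (hθ0 : 0 ≤ θ) (hθ1 : θ ≤ 1) :
    ∫⁻ ω, S ω ^ θ ∂μ ≤ ENNReal.ofReal (2 * M ^ θ) := by
  set m := ENNReal.ofReal M with hm
  have hm0 : m ≠ 0 := by simpa [hm] using hM
  have hmt : m ≠ ∞ := ENNReal.ofReal_ne_top
  have hpt : ∀ ω, S ω ^ θ ≤ m ^ θ * (1 + m⁻¹ * S ω) := by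
    intro ω
    have h1 : S ω = m * (m⁻¹ * S ω) := by
      rw [← mul_assoc, ENNReal.mul_inv_cancel hm0 hmt, one_mul]
    -- `tᶿ ≤ 1 + t` for `t = S / M`
    conv_lhs => rw [h1, ENNReal.mul_rpow_of_nonneg _ _ hθ0]
    gcongr
    rcases le_total (m⁻¹ * S ω) 1 with h2 | h2
    · exact le_add_right (ENNReal.rpow_le_one h2 hθ0)
    · refine le_add_left ?_
      calc (m⁻¹ * S ω) ^ θ ≤ (m⁻¹ * S ω) ^ (1 : ℝ) := ENNReal.rpow_le_rpow_of_exponent_le h2 hθ1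
        _ = _ := ENNReal.rpow_one _
  refine (lintegral_mono hpt).trans ?_
  rw [lintegral_const_mul' _ _ (ENNReal.rpow_ne_top_of_nonneg hθ0 hmt),
    lintegral_add_left measurable_const, lintegral_const_mul' _ _ (ENNReal.inv_ne_top.2 hm0),
    lintegral_const, measure_univ, mul_one, mul_comm 2 (M ^ θ),
    ENNReal.ofReal_mul (Real.rpow_nonneg hM.le _), ← ENNReal.ofReal_rpow_of_pos hM, ← hm,
    ENNReal.ofReal_ofNat]
  gcongr
  calc 1 + m⁻¹ * ∫⁻ ω, S ω ∂μ ≤ 1 + m⁻¹ * m := by gcongr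
    _ = 2 := by rw [ENNReal.inv_mul_cancel hm0 hmt, one_add_one_eq_two]

/-- Passing from an integrable random constant to one with a given moment, at the cost of the
rate: since all correlations are bounded by one, the random constant may be raised to a small
power. -/
theorem exists_random_constant_of_moment {Ω : Type*} [MeasurableSpace Ω] {μ : Measure Ω}
    [IsProbabilityMeasure μ] {S : Ω → ℝ≥0∞} (hS : Measurable S) (hS1 : ∀ ω, 1 ≤ S ω) {M θ κ q : ℝ}
    (hM : 0 < M) (h : ∫⁻ ω, S ω ∂μ ≤ ENNReal.ofReal M) (hθ0 : 0 ≤ θ) (hθ1 : θ ≤ 1)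
    (hκ0 : 0 ≤ κ) (hκ1 : κ ≤ 1) (hq : 0 < q) :
    ∃ D : Ω → ℝ≥0, Measurable D ∧
      (∀ ω, S ω ≠ ∞ → ∀ t u x : ℝ, x ≤ u → 0 ≤ u → x ≤ ((S ω).toReal * exp (-t)) ^ κ * u →
        x ≤ D ω * exp (-(κ * θ / (1 + q) * t)) * u) ∧
      ∫⁻ ω, (D ω : ℝ≥0∞) ^ q ∂μ ≤ ENNReal.ofReal (2 * M ^ θ) := by
  set σ := θ / (1 + q) with hσ
  have hσ0 : 0 ≤ σ := by positivity
  have hσ1 : σ ≤ 1 := (div_le_one (by linarith)).2 (by linarith)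
  have hσq : σ * q ≤ θ := by
    rw [hσ, div_mul_eq_mul_div, div_le_iff₀ (by linarith)]
    nlinarith
  refine ⟨fun ω => (S ω).toNNReal ^ (κ * σ), hS.ennreal_toNNReal.pow_const _, ?_, ?_⟩
  · intro ω hω t u x hxu hu hx
    set s := (S ω).toReal with hs
    have hs1 : 1 ≤ s := by
      rw [← ENNReal.toReal_one]
      exact (ENNReal.toReal_le_toReal ENNReal.one_ne_top hω).2 (hS1 ω)
    have hs0 : 0 < s := one_pos.trans_le hs1
    set Y := s * exp (-t) with hY
    have hY0 : 0 < Y := mul_pos hs0 (Real.exp_pos _)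
    have hD : (((S ω).toNNReal ^ (κ * σ) : ℝ≥0) : ℝ) * exp (-(κ * θ / (1 + q) * t)) =
        Y ^ (κ * σ) := by
      rw [NNReal.coe_rpow, ENNReal.coe_toNNReal_eq_toReal, hY,
        Real.mul_rpow hs0.le (Real.exp_pos _).le, ← Real.exp_mul, hσ]
      congr 2
      ring
    simp only
    rw [hD]
    rcases le_total 1 Y with h1 | h1
    · exact hxu.trans (le_mul_of_one_le_left hu (Real.one_le_rpow h1 (by positivity)))
    · refine hx.trans (mul_le_mul_of_nonneg_right ?_ hu)
      exact Real.rpow_le_rpow_of_exponent_ge hY0 h1 (mul_le_of_le_one_right hκ0 hσ1)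
  · refine (lintegral_mono fun ω => ?_).trans (lintegral_rpow_le_two_mul hM h hθ0 hθ1)
    have hexp : κ * σ * q ≤ θ := by
      rw [mul_assoc]
      exact (mul_le_of_le_one_left (by positivity) hκ1).trans hσq
    calc (((S ω).toNNReal ^ (κ * σ) : ℝ≥0) : ℝ≥0∞) ^ q = ((S ω).toNNReal : ℝ≥0∞) ^ (κ * σ * q) := by
          rw [ENNReal.coe_rpow_of_nonneg _ (by positivity),
            ← ENNReal.rpow_mul]
      _ ≤ S ω ^ (κ * σ * q) := ENNReal.rpow_le_rpow ENNReal.coe_toNNReal_le_self (by positivity)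
      _ ≤ S ω ^ θ := ENNReal.rpow_le_rpow_of_exponent_le (hS1 ω) hexp

/-! ### Exponential mixing -/

theorem MeanZeroH1.eq_zero_of_dim_eq_zero {φ : T 0 → ℂ} (hφ : MeanZeroH1 φ) : φ = 0 := by
  have h := hφ.mean_zero
  have h1 : ∀ x, φ x = φ default := fun x => congrArg φ (Subsingleton.elim _ _)
  simp only [h1, integral_const, probReal_univ, one_smul] at h
  funext x
  rw [h1 x, h]
  rfl

theorem le_torusDist_of_lyapunov_le {p s : ℝ} (hp : 0 < p) (hs : 0 < s) {z : T d × T d}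
    (h : lyapunov p z ≤ ENNReal.ofReal (s ^ (-p))) : s ≤ torusDist z.1 z.2 := by
  by_contra! hlt
  refine absurd h (not_le.2 ?_)
  rw [← ENNReal.ofReal_rpow_of_pos hs, lyapunov, ENNReal.rpow_neg, ENNReal.rpow_neg,
    ENNReal.inv_lt_inv]
  exact ENNReal.rpow_lt_rpow ((ENNReal.ofReal_lt_ofReal_iff hs).2 hlt) hp

end TorusMixing

theorem theorem3p1 (d : ℕ) (p : ℝ) (hp : p ∈ Set.Ioo (0 : ℝ) 1) :
    -- the constant in the rate depends only on the dimension and on the exponent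
    ∃ C' : ℝ, 0 < C' ∧
      ∀ (P₀ : Measure (TorusMixing.E d)) [IsProbabilityMeasure P₀]
        (f : ℝ → TorusMixing.C2Family d)
        (_ : ∀ A : ℝ, 0 < A → TorusMixing.StandingHypothesis P₀ (f A))
        -- uniform contraction
        (m : ℕ) (γ' : ℝ) (_ : γ' ∈ Set.Ioo (0 : ℝ) (1 / 2))
        (_ : ∀ A : ℝ, 0 < A → ∀ x v : TorusMixing.E d, ‖v‖ = 1 →
          ∫⁻ ω, ‖(f A).DIter m ω x v‖ₑ ^ (-p) ∂(TorusMixing.noiseLaw P₀) ≤ ENNReal.ofReal γ')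
        -- derivative bounds
        (C₁ : ℝ → ℝ)
        (_ : ∀ A : ℝ, 0 < A → ∀ n ≤ m, ∀ᵐ ω ∂(TorusMixing.noiseLaw P₀), ∀ x,
          ‖(f A).DIter n ω x‖ ≤ C₁ A ∧ ‖(f A).D2Iter n ω x‖ ≤ C₁ A)
        (_ : Tendsto C₁ atTop atTop)
        -- small sets away from the diagonal
        (k : ℝ → ℝ → ℕ) (C₂ : ℝ → ℝ → ℝ)
        (_ : ∀ A : ℝ, 0 < A → ∀ s : ℝ, 0 < s →
          C₂ A s ∈ Set.Ioo (0 : ℝ) 1 ∧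
          ∃ ν : Measure (TorusMixing.T d × TorusMixing.T d), IsProbabilityMeasure ν ∧
            ∀ x y, s ≤ TorusMixing.torusDist x y →
              ENNReal.ofReal (C₂ A s) • ν ≤ TorusMixing.twoPoint P₀ (f A) (m * k A s) x y),
        ∃ A₀ C'' s' : ℝ, 0 < A₀ ∧ 0 < C'' ∧ 0 < s' ∧
          ∀ q : ℝ, 0 < q → ∀ A : ℝ, A₀ ≤ A →
            ∃ D : (ℕ → TorusMixing.E d) → ℝ≥0, Measurable D ∧
              -- almost sure decay of correlations
              (∀ᵐ ω ∂(TorusMixing.noiseLaw P₀),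
                ∀ φ ψ : TorusMixing.T d → ℂ,
                  TorusMixing.MeanZeroH1 φ → TorusMixing.MeanZeroH1 ψ → ∀ n : ℕ,
                  ‖∫ x, φ x * ψ ((f A).iter n ω x) ∂(TorusMixing.leb d)‖ ≤
                    D ω *
                      exp (-(C' / (1 + q) *
                        min (C₂ A (C₁ A ^ (-(2 * (d : ℤ) - 1)) * s'))
                          ((m * k A (C₁ A ^ (-(2 * (d : ℤ) - 1)) * s') : ℝ)⁻¹) ^ 2 * n)) *
                      TorusMixing.H1norm φ * TorusMixing.H1norm ψ) ∧
              -- moment bound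
              ∫⁻ ω, (D ω : ℝ≥0∞) ^ q ∂(TorusMixing.noiseLaw P₀) ≤
                ENNReal.ofReal
                  (C'' * (2 : ℝ) ^ ((k A (C₁ A ^ (-(2 * (d : ℤ) - 1)) * s') : ℝ) / 2) *
                    C₁ A ^ (((d : ℝ) - 1) * p / 2)) := by
  rcases Nat.eq_zero_or_pos d with rfl | hd
  · -- on a point there are no nonzero functions of mean zero
    refine ⟨1, one_pos, ?_⟩
    intro P₀ _ f _ m γ' _ _ C₁ _ _ k C₂ _
    refine ⟨1, 1, 1, one_pos, one_pos, one_pos, fun q hq A _ => ⟨0, measurable_const, ?_, ?_⟩⟩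
    · refine Eventually.of_forall fun ω φ ψ hφ _ n => ?_
      simp [hφ.eq_zero_of_dim_eq_zero]
    · simp [ENNReal.zero_rpow_of_pos hq]
  obtain ⟨Γ, hΓ1, hΓ⟩ := TorusMixing.exists_random_constant hd hp
  set κ : ℝ := 1 / (2 * ((d : ℝ) + 2)) with hκ
  have hκ0 : 0 < κ := by positivity
  have hκ1 : κ ≤ 1 := by
    rw [hκ, div_le_one (by positivity)]
    linarith [Nat.cast_nonneg (α := ℝ) d]
  refine ⟨κ / 64, by positivity, ?_⟩
  intro P₀ _ f hf m γ' hγ hcontr C₁ hbound hC₁ k C₂ hsmall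
  obtain ⟨hγ0, hγ2⟩ := hγ
  set c := 2 * γ' * (1 - 2 * γ') with hc
  have hc0 : 0 < c := mul_pos (by linarith) (by linarith)
  have hc1 : c ≤ 1 := by
    rw [hc]
    nlinarith [sq_nonneg (1 - 4 * γ')]
  set s' := c * (32 : ℝ) ^ (-p⁻¹) with hs'
  have hs'0 : 0 < s' := by positivity
  obtain ⟨A₁, hA₁⟩ := Filter.eventually_atTop.1 (hC₁.eventually_ge_atTop 1)
  refine ⟨max A₁ 1, 6 * Γ * (√m + 1), s', lt_max_of_lt_right one_pos, by positivity, hs'0, ?_⟩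
  intro q hq A hA
  have hA0 : 0 < A := one_pos.trans_le ((le_max_right _ _).trans hA)
  have hC : 1 ≤ C₁ A := hA₁ A ((le_max_left _ _).trans hA)
  set C := C₁ A with hCdef
  have hC0 : 0 < C := one_pos.trans_le hC
  set s := C ^ (-(2 * (d : ℤ) - 1)) * s' with hs
  have hs0 : 0 < s := by positivity
  obtain ⟨hα, ν, hν, hmin⟩ := hsmall A hA0 s hs0
  set α := C₂ A s with hαdef
  have hCpow : 1 ≤ C ^ (((d : ℝ) - 1) * p / 2) := by
    refine Real.one_le_rpow hC ?_
    have : (1 : ℝ) ≤ d := by exact_mod_cast hd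
    have := mul_nonneg (by linarith : (0 : ℝ) ≤ (d : ℝ) - 1) hp.1.le
    linarith
  have h2k : 1 ≤ (2 : ℝ) ^ ((k A s : ℝ) / 2) := Real.one_le_rpow one_le_two (by positivity)
  rcases Nat.eq_zero_or_pos (m * k A s) with hmk | hmk
  · -- the rate vanishes, because `0⁻¹ = 0`, and the trivial bound on correlations suffices
    refine ⟨fun _ => 1, measurable_const, ?_, ?_⟩
    · filter_upwards [TorusMixing.ae_measurePreserving_iter (hf A hA0)] with ω hω φ ψ hφ hψ n
      have hmk' : (m : ℝ) * k A s = 0 := by exact_mod_cast hmk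
      rw [hmk', inv_zero, min_eq_right hα.1.le]
      simpa using hφ.norm_integral_mul_comp_le hψ (hω n)
    · simp only [ENNReal.coe_one, ENNReal.one_rpow, lintegral_const, measure_univ, mul_one,
        ENNReal.one_le_ofReal]
      have h1 : 1 ≤ 6 * Γ * (√m + 1) := by
        nlinarith [Real.sqrt_nonneg m]
      exact one_le_mul_of_one_le_of_one_le (one_le_mul_of_one_le_of_one_le h1 h2k) hCpow
  set L := m * k A s with hL
  have hk : 0 < k A s := Nat.pos_of_mul_pos_left hmk
  have hLr : (m : ℝ) * k A s = L := by rw [hL]; push_cast; rfl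
  have hL1 : (1 : ℝ) ≤ L := by exact_mod_cast hmk
  -- the constant of the drift condition
  set K := (c / C ^ (2 * d - 1)) ^ (-p) with hK
  have hcC : 0 < c / C ^ (2 * d - 1) := by positivity
  have hK1 : 1 ≤ K :=
    Real.one_le_rpow_of_pos_of_le_one_of_nonpos hcC
      ((div_le_one (by positivity)).2 (hc1.trans (one_le_pow₀ hC))) (by linarith [hp.1])
  have hdrift1 : ∀ z, TorusMixing.lTransition P₀ (f A) m (TorusMixing.lyapunov p) z ≤
      2⁻¹ * TorusMixing.lyapunov p z + ENNReal.ofReal K := by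
    intro z
    have := TorusMixing.lTransition_lyapunov_le hd (hf A hA0) hp ⟨hγ0, hγ2⟩ (hcontr A hA0) hC
      (hbound A hA0 m le_rfl) z
    rwa [ENNReal.ofReal_rpow_of_pos hcC] at this
  have hdrift := TorusMixing.lTransition_mul_le (TorusMixing.measurable_lyapunov p) hdrift1
    (k A s) hk
  -- the small set contains a sublevel set of the Lyapunov function which is large enough
  have hsK : s ^ (-p) = 32 * K := by
    have hzpow : s = c / C ^ (2 * d - 1) * (32 : ℝ) ^ (-p⁻¹) := by
      have : (2 * (d : ℤ) - 1) = ((2 * d - 1 : ℕ) : ℤ) := by omega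
      rw [hs, hs', zpow_neg, this, zpow_natCast]
      ring
    rw [hzpow, Real.mul_rpow hcC.le (by positivity), ← Real.rpow_mul (by norm_num), neg_mul_neg,
      inv_mul_cancel₀ hp.1.ne', Real.rpow_one, hK, mul_comm]
  obtain ⟨S, hSm, hS1, hSM, hSae⟩ := hΓ P₀ (f A) (hf A hA0) L hmk K α hK1 hα hdrift ν
    fun z hz => hmin z.1 z.2 (TorusMixing.le_torusDist_of_lyapunov_le hp.1 hs0 (hsK ▸ hz))
  set θ := min α (L : ℝ)⁻¹ / (4 * max α (L : ℝ)⁻¹) with hθ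
  have hα0 := hα.1
  have hLinv : 0 < (L : ℝ)⁻¹ := by positivity
  have hmax : 0 < max α (L : ℝ)⁻¹ := lt_max_of_lt_left hα0
  have hmin0 : 0 < min α (L : ℝ)⁻¹ := lt_min hα0 hLinv
  have hθ0 : 0 ≤ θ := by positivity
  have hθ1 : θ ≤ 1 := (div_le_one (by positivity)).2 (by
    linarith [min_le_max (a := α) (b := (L : ℝ)⁻¹)])
  have hM0 : 0 < Γ * (L / α) := by positivity
  obtain ⟨D, hDm, hD, hDq⟩ := TorusMixing.exists_random_constant_of_moment hSm hS1 hM0 hSM hθ0 hθ1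
    hκ0.le hκ1 hq
  refine ⟨D, hDm, ?_, hDq.trans (ENNReal.ofReal_le_ofReal ?_)⟩
  · filter_upwards [hSae, TorusMixing.ae_measurePreserving_iter (hf A hA0)]
      with ω hω hpres φ ψ hφ hψ n
    have h1 := hD ω hω.1 (α / (16 * L) * n) (TorusMixing.H1norm φ * TorusMixing.H1norm ψ) _
      (hφ.norm_integral_mul_comp_le hψ (hpres n))
      (mul_nonneg (TorusMixing.H1norm_nonneg φ) (TorusMixing.H1norm_nonneg ψ))
      (hω.2 φ ψ hφ hψ n)
    have hrate : κ * θ / (1 + q) * (α / (16 * L) * n) =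
        κ / 64 / (1 + q) * min α (L : ℝ)⁻¹ ^ 2 * n := by
      have h2 : α * (L : ℝ)⁻¹ = min α (L : ℝ)⁻¹ * max α (L : ℝ)⁻¹ := (min_mul_max _ _).symm
      have h3 : α / (16 * L) = min α (L : ℝ)⁻¹ * max α (L : ℝ)⁻¹ / 16 := by
        rw [← h2]
        field_simp
      rw [h3, hθ]
      field_simp
      ring
    rw [hrate] at h1
    rw [hLr, mul_assoc _ (TorusMixing.H1norm φ)]
    exact h1
  · have hLα : 1 ≤ L / α := by
      rw [le_div_iff₀ hα0]
      linarith [hα.2]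
    have h1 : (Γ * (L / α)) ^ θ ≤ Γ * (3 * √L) := by
      rw [Real.mul_rpow (by linarith) (by linarith)]
      refine mul_le_mul ?_ (TorusMixing.rpow_min_div_max_le hα hmk) (by positivity) (by linarith)
      calc Γ ^ θ ≤ Γ ^ (1 : ℝ) := Real.rpow_le_rpow_of_exponent_le hΓ1 hθ1
        _ = Γ := Real.rpow_one Γ
    have h2 : √(L : ℝ) ≤ √m * (2 : ℝ) ^ ((k A s : ℝ) / 2) := by
      have h3 : √(k A s : ℝ) ≤ (2 : ℝ) ^ ((k A s : ℝ) / 2) := by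
        refine Real.sqrt_le_iff.2 ⟨by positivity, ?_⟩
        rw [← Real.rpow_natCast, ← Real.rpow_mul two_pos.le]
        have h4 : (k A s : ℝ) / 2 * (2 : ℕ) = (k A s : ℕ) := by
          push_cast
          ring
        rw [h4, Real.rpow_natCast]
        exact_mod_cast Nat.lt_two_pow_self.le
      rw [← hLr, Real.sqrt_mul (Nat.cast_nonneg _)]
      gcongr
    calc 2 * (Γ * (L / α)) ^ θ ≤ 2 * (Γ * (3 * (√m * (2 : ℝ) ^ ((k A s : ℝ) / 2)))) := by
          gcongr
          exact h1.trans (by gcongr)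
      _ = 6 * Γ * √m * (2 : ℝ) ^ ((k A s : ℝ) / 2) * 1 := by ring
      _ ≤ 6 * Γ * (√m + 1) * (2 : ℝ) ^ ((k A s : ℝ) / 2) * C ^ (((d : ℝ) - 1) * p / 2) := by
          gcongr
          linarith
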